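/- Let $q$ be a prime power, let $m>3$ be an integer, put $n=q^{2m}-1$, and let \[\delta_h=\begin{cases}(q^m-1)^2 & m \text{ odd},\\ q^{2m}-1-q^{m-1} & m\text{ even.}\end{cases}\] Let $d<\delta_h$ be a non-negative integer. A linear code $C\subseteq\mathbb F_{q^2}^{n\times n}$ is bicyclic if it is closed under cyclic shifts of rows and of columns; given primitive $n$-th roots of unity $\alpha,\beta$, its defining set is the set of all $(x,y)\in\{0,\dots,n-1\}^2$ such that $\sum_{i,j}c_{i,j}\alpha^{xi}\beta^{yj}=0$ for all $c\in C$. It is the primitive narrow-sense hyperbolic code of designed distance $d$ if, for some such $\alpha,\beta$, its defining set is the set of all $(xq^{2k}\bmod n,\;yq^{2k}\bmod n)$ with $k\ge 0$, $1\le x,y\le n$ and $xy<d$. The Hermitian dual of $C$ is $C^{\perp_h}=\{u\in\mathbb F_{q^2}^{n\times n} : \sum_{i,j}u_{i,j}^q c_{i,j}=0 \text{ for all } c\in C\}$. Then there is a primitive narrow-sense bicyclic hyperbolic code $C$ over $\mathbb F_{q^2}$ of length $n\times n$ and designed distance $d$ with $C^{\perp_h}\subseteq C$ and $k=\dim_{\mathbb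 F_{q^2}} C>n^2/2$, and there is a stabilizer code $Q\subseteq(\mathbb C^q)^{\otimes n^2}$ over $\mathbb F_q$, obtained from $C$ by the Hermitian construction, of length $n^2$, dimension $q^{2k-n^2}>1$ and minimum distance at least $d$. That is: $Q\neq 0$ is the joint $+1$-eigenspace of a group $S$ of operators $\lambda X(a)Z(b)$ with $|\lambda|=1$ and $a,b\in\mathbb F_q^{n\times n}$, where $X(a)|x\rangle=|x+a\rangle$ and $Z(b)|x\rangle=e^{2\pi i\,\mathrm{tr}(b\cdot x)/p}|x\rangle$, with $p$ the characteristic of $\mathbb F_q$ and $\mathrm{tr}$ the trace from $\mathbb F_q$ to $\mathbb F_p$; for some normal basis $(\theta,\theta^q)$ of $\mathbb F_{q^2}$ over $\mathbb F_q$, a multiple of $X(a)Z(b)$ lies in $S$ if and only if $\theta a+\theta^q b\in C^{\perp_h}$; and for every error $E=X(a)Z(b)$ acting nontrivially on fewer than $d$ of the $n^2$ coordinates there is a scalar $c_E$ with $\langle u|E|v\rangle=c_E\langle u|v\rangle$ for all $u,v\in Q$. -/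

import Mathlib

noncomputable section

/-! ### Bicyclic codes and hyperbolic codes -/

section Bicyclic

variable {K : Type*} [Field K] [Fintype K] {n₁ n₂ : ℕ}

/-- A linear code of `n₁ × n₂` arrays over `K` is bicyclic if `gcd(n₁ n₂, |K|) = 1` and it is
closed under the circular right shift of columns and the circular down shift of rows
(`finRotate n` is `i ↦ i + 1` modulo `n`). -/
structure IsBicyclic (C : Submodule K (Fin n₁ × Fin n₂ → K)) : Prop where
  coprime : Nat.Coprime (n₁ * n₂) (Fintype.card K)
  shift_columns : ∀ c ∈ C, (fun ij => c (ij.1, (finRotate n₂).symm ij.2)) ∈ C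
  shift_rows : ∀ c ∈ C, (fun ij => c ((finRotate n₁).symm ij.1, ij.2)) ∈ C

/-- The value `c(X, Y) = ∑ c_{ij} X^i Y^j` of the code polynomial of `c` at a point of an
extension field. -/
def codePolyEval {L : Type*} [Field L] [Algebra K L] (c : Fin n₁ × Fin n₂ → K) (X Y : L) : L :=
  ∑ ij : Fin n₁ × Fin n₂, algebraMap K L (c ij) * X ^ (ij.1 : ℕ) * Y ^ (ij.2 : ℕ)

/-- The defining set of `C`: all exponents `(x, y)` such that `(α^x, β^y)` is a common zero of
the code polynomials of `C`. -/
def definingSet {L : Type*} [Field L] [Algebra K L] (α β : L)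
    (C : Submodule K (Fin n₁ × Fin n₂ → K)) : Set (ℕ × ℕ) :=
  {z | z.1 < n₁ ∧ z.2 < n₂ ∧ ∀ c ∈ C, codePolyEval c (α ^ z.1) (β ^ z.2) = 0}

/-- The `Q`-ary cyclotomic coset of `(x, y)` modulo `n₁` and `n₂`. -/
def cyclotomicCoset₂ (Q n₁ n₂ : ℕ) (z : ℕ × ℕ) : Set (ℕ × ℕ) :=
  Set.range fun k : ℕ => (z.1 * Q ^ k % n₁, z.2 * Q ^ k % n₂)

/-- The designed set of a hyperbolic code with designed distance `δ` and offsets `a`, `b`. -/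
def designedSet (n₁ n₂ a b δ : ℕ) : Set (ℕ × ℕ) :=
  {z | ∃ x y : ℕ, 1 ≤ x ∧ x ≤ n₁ ∧ 1 ≤ y ∧ y ≤ n₂ ∧ x * y < δ ∧
    z = ((a + x) % n₁, (b + y) % n₂)}

/-- `C` is a bicyclic hyperbolic code over `K` with offsets `a`, `b` and designed distance `δ`:
each `n_i` has the form `|K|^{m_i} - 1`, and for some primitive `n₁`-th and `n₂`-th roots of unity
`α`, `β` the defining set of `C` is the union of the `|K|`-ary cyclotomic cosets of the points of
the designed set. -/
structure IsHyperbolicCode (a b δ : ℕ) (C : Submodule K (Fin n₁ × Fin n₂ → K)) : Prop where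
  length₁ : ∃ m₁ : ℕ, n₁ = Fintype.card K ^ m₁ - 1
  length₂ : ∃ m₂ : ℕ, n₂ = Fintype.card K ^ m₂ - 1
  bicyclic : IsBicyclic C
  zeros : ∃ α β : AlgebraicClosure K, IsPrimitiveRoot α n₁ ∧ IsPrimitiveRoot β n₂ ∧
    definingSet α β C =
      ⋃ z ∈ designedSet n₁ n₂ a b δ, cyclotomicCoset₂ (Fintype.card K) n₁ n₂ z

/-- The primitive (`n₁ = n₂ = n`) narrow-sense (`a = b = 0`) hyperbolic codes
`ℋ(n × n, |K|; δ)`. -/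
def IsPrimitiveNarrowSenseHyperbolic {n : ℕ} (δ : ℕ)
    (C : Submodule K (Fin n × Fin n → K)) : Prop :=
  IsHyperbolicCode 0 0 δ C

end Bicyclic

/-- The Hermitian dual `{u | ∑ u_i^q c_i = 0 for all c ∈ C}` of a code over `K`, where `q = |F|`
and `K` is the quadratic extension of `F`. -/
def hermitianDual (F : Type*) [Fintype F] {K ι : Type*} [Field K] [Fintype ι]
    (C : Submodule K (ι → K)) : Set (ι → K) :=
  {u | ∀ c ∈ C, ∑ i, u i ^ Fintype.card F * c i = 0}

/-- The bound `δ_h`. -/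
def deltaH (q m : ℕ) : ℕ :=
  if Odd m then (q ^ m - 1) ^ 2 else q ^ (2 * m) - 1 - q ^ (m - 1)

/-! ### Stabilizer codes over a finite field `F` of characteristic `p` -/

section Stabilizer

variable (p : ℕ) [Fact p.Prime] {F : Type*} [Field F] [Fintype F] [Algebra (ZMod p) F]
variable {ι : Type*} [Fintype ι]

/-- The state space `(ℂ^q)^{⊗ ι}` of qudits indexed by `ι`, with orthonormal basis the kets
`|x⟩` for `x ∈ F^ι`. -/
abbrev QuditSpace (F ι : Type*) : Type _ := EuclideanSpace ℂ (ι → F)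

/-- The operator `X(a) : |x⟩ ↦ |x + a⟩`. -/
def shiftX (a : ι → F) : QuditSpace F ι →ₗ[ℂ] QuditSpace F ι where
  toFun ψ := WithLp.toLp 2 fun x => ψ (x - a)
  map_add' _ _ := by ext x; simp
  map_smul' _ _ := by ext x; simp

/-- The operator `Z(b) : |x⟩ ↦ exp(2πi tr(b · x) / p) |x⟩`, with `tr` the trace from `F` to the
prime field. -/
def phaseZ (b : ι → F) : QuditSpace F ι →ₗ[ℂ] QuditSpace F ι where
  toFun ψ := WithLp.toLp 2 fun x =>
    ZMod.stdAddChar (Algebra.trace (ZMod p) F (∑ i, b i * x i)) * ψ x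
  map_add' _ _ := by ext x; simp [mul_add]
  map_smul' _ _ := by ext x; simp [mul_left_comm]

/-- The error operator `X(a) Z(b)`. -/
def errorOp (a b : ι → F) : QuditSpace F ι →ₗ[ℂ] QuditSpace F ι :=
  shiftX a ∘ₗ phaseZ p b

/-- The number of qudits on which `X(a) Z(b)` acts nontrivially. -/
def errorWeight (a b : ι → F) : ℕ := {i | a i ≠ 0 ∨ b i ≠ 0}.ncard

/-- `Q` is the stabilizer code of the group `S`: `S` is a group of error operators up to phases,
and `Q` is nonzero and is the joint eigenspace of `S` for the eigenvalue one. (Since `Q ≠ 0`, the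
group `S` contains no scalar but the identity; hence it is abelian and its phases are roots of
unity.) -/
structure IsStabilizerCode (S : Subgroup (QuditSpace F ι ≃ₗ[ℂ] QuditSpace F ι))
    (Q : Submodule ℂ (QuditSpace F ι)) : Prop where
  error : ∀ E ∈ S, ∃ (c : ℂ) (a b : ι → F), ‖c‖ = 1 ∧
    (E : QuditSpace F ι →ₗ[ℂ] QuditSpace F ι) = c • errorOp p a b
  mem_iff : ∀ v, v ∈ Q ↔ ∀ E ∈ S, E v = v
  ne_bot : Q ≠ ⊥

/-- `Q` has minimum distance at least `d`: it detects every error of weight less than `d`, that is,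
`⟨u| E |v⟩ = c_E ⟨u|v⟩` on `Q` with `c_E` independent of `u`, `v`. -/
def HasDistanceAtLeast [DecidableEq ι] (d : ℕ) (Q : Submodule ℂ (QuditSpace F ι)) : Prop :=
  ∀ a b : ι → F, errorWeight a b < d →
    ∃ c : ℂ, ∀ u ∈ Q, ∀ v ∈ Q, inner ℂ u (errorOp p a b v) = c * inner ℂ u v

/-- `Q` is a stabilizer code over `F` obtained from the classical code `C` over the quadratic
extension `K` by the Hermitian construction: for some normal basis `(θ, θ^q)` of `K` over `F`, the
operators `X(a) Z(b)` that occur, up to a phase, in the stabilizer of `Q` are exactly those for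
which `θ a + θ^q b` lies in the Hermitian dual of `C`. -/
def IsHermitianConstruction {K : Type*} [Field K] [Algebra F K]
    (C : Submodule K (ι → K)) (Q : Submodule ℂ (QuditSpace F ι)) : Prop :=
  ∃ θ : K, LinearIndependent F ![θ, θ ^ Fintype.card F] ∧
    ∃ S : Subgroup (QuditSpace F ι ≃ₗ[ℂ] QuditSpace F ι), IsStabilizerCode p S Q ∧
      ∀ a b : ι → F,
        (∃ E ∈ S, ∃ c : ℂ, (E : QuditSpace F ι →ₗ[ℂ] QuditSpace F ι) = c • errorOp p a b) ↔
          (fun i => a i • θ + b i • θ ^ Fintype.card F) ∈ hermitianDual F C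

end Stabilizer

end

/-!
# Quantum codes from primitive narrow-sense hyperbolic codes

Let `Z` be the union of the `q²`-ary cyclotomic cosets of the points `(x, y)` with `1 ≤ x, y ≤ n` and
`x y < d`, let `α` be a primitive `n`-th root of unity, and let `C` be the code of all arrays whose
Fourier transforms vanish on `Z` (`zeroCode`).

Since `Z` is stable under multiplication by `q²`, the inverse transform of the indicator function of
its complement has entries in the field with `q²` elements (`exists_generator`). This one codeword
shows that `Z` is the exact defining set of `C`, and its translates show, by injectivity of the
Fourier transform, that `C` contains its Hermitian dual if `Z` and `-q Z` are disjoint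
(`hermitianDual_zeroCode_subset`). As `(0, 0) ∉ Z`, the all-ones array lies in `C` but not in the
Hermitian dual, so the dimension of `C` exceeds `n² / 2` without any count of cosets.

Disjointness of `Z` and `-q Z` for `d < δ_h` is elementary arithmetic (`not_dvd_of_odd`). A common
point gives `x' ≡ -L x` and `y' ≡ -L y` modulo `n`, with `L = q ^ l` for some odd `l ≤ m`,
`M = q ^ (2 m - l)` and `n = L M - 1`, and the larger of the products `x y` and `x' y'` is at least
`δ_h`. For `l < m` one has `4 L ≤ M`, and the extremal case is `(x, y) = (n - M, 1)`,
`(x', y') = (1, n - L)`. For `l = m` it is `x = y = x' = y' = q ^ m - 1`.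

The minimum distance of `C` is at least `d` by the hyperbolic bound
(`le_card_support_of_codePolyEval_eq_zero`): if `(x, y)` is the lexicographically least point at
which the transform of a codeword `c` does not vanish, then `x y ≥ d`, and the `x y` characters with
exponents in `[0, x) × [0, y)` are linearly independent on the support of `c`.

For the quantum code, a normal basis `(θ, θ^q)` identifies pairs `(a, b)` with vectors
`θ a + θ^q b`, and the symplectic form with the Hermitian form minus its conjugate, up to a nonzero
factor (`hermitian_sub_conj`). Thus the labels in the Hermitian dual index commuting operators
`X(a) Z(b)`. Rescaled to fix a common eigenvector, they form a representation of the group of labels.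
Its invariants are the code `Q`, and the average of its character, which vanishes off the identity,
is the dimension (`exists_stabilizerCode`). An error of weight less than `d` either fails to commute
with some stabilizer element, and then maps `Q` into its orthogonal complement, or is labelled by a
codeword of `C` of weight less than `d`, and is then the identity.
-/

/-! ### Arithmetic of the bound `δ_h` -/

/-- A coordinate `y' ≥ n / 2` forces `x' = 1`, hence `x = n - M`, hence `y = 1`, hence
`y' = n - L`, contradicting `x' y' < n - L`. -/
theorem not_dvd_of_half_le {L M n x y x' y' : ℤ} (hL : 2 ≤ L) (hM : 4 * L ≤ M) (hn : n = L * M - 1)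
    (hx : 1 ≤ x) (hx' : 1 ≤ x') (hy : 1 ≤ y) (hy' : 1 ≤ y')
    (hxn : x ≤ n)
    (h1 : n ∣ x + M * x') (h2 : n ∣ y' + L * y)
    (hxy : x * y < n - L) (hxy' : x' * y' < n - L) (hhalf : n ≤ 2 * y') : False := by
  have hn2 : 2 * M - 1 ≤ n := by nlinarith
  have hx1 : x' = 1 := by
    by_contra h
    have : 2 ≤ x' := by omega
    nlinarith
  subst hx1
  obtain ⟨r, hr⟩ := h1
  have hr1 : r = 1 := by
    have : 0 < r := by by_contra h; nlinarith
    have : r < 2 := by by_contra h; nlinarith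
    omega
  subst hr1
  have hy1 : y = 1 := by
    by_contra h
    have : 2 ≤ y := by omega
    have : x = n - M := by linarith
    nlinarith
  subst hy1
  obtain ⟨t, ht⟩ := h2
  have ht1 : t = 1 := by
    have : 0 < t := by by_contra h; nlinarith
    have : t < 2 := by by_contra h; nlinarith
    omega
  subst ht1
  linarith

/-- For `y < M` there is no reduction modulo `n`: the residue of `-L y` is `n - L y`. -/
theorem eq_sub_of_dvd {L M n y y' : ℤ} (hL : 2 ≤ L) (hn : n = L * M - 1)
    (hy : 1 ≤ y) (hy' : 1 ≤ y') (hyn' : y' ≤ n) (h2 : n ∣ y' + L * y) (hyM : y < M) :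
    y' = n - L * y := by
  obtain ⟨t, ht⟩ := h2
  have h3 : L * y ≤ L * (M - 1) := mul_le_mul_of_nonneg_left (by omega) (by omega)
  have h4 : 0 < L * y := by positivity
  have ht1 : t = 1 := by
    have : 0 < t := by by_contra h; nlinarith
    have : t < 2 := by by_contra h; nlinarith
    omega
  subst ht1
  linarith

/-- Since `L M ≡ 1` modulo `n`, the congruence `x' ≡ -L x` is symmetric under exchange of `x` with
`x'` and `L` with `M`. -/
theorem dvd_add_mul_of_dvd {L M n x x' : ℤ} (hn : n = L * M - 1) (h : n ∣ x' + L * x) :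
    n ∣ x + M * x' := by
  obtain ⟨s, hs⟩ := h
  exact ⟨M * s - x, by rw [mul_sub, mul_left_comm, ← hs, hn]; ring⟩

/-- The two congruences with `L ≠ M`: if both `x'` and `y'` are below `n / 2`, then `x` and `y` are
both large enough for `x y ≥ n - L`, by whether each of them is below `M`. -/
theorem not_dvd_of_four_mul_le {L M n x y x' y' : ℤ} (hL : 2 ≤ L) (hM : 4 * L ≤ M)
    (hn : n = L * M - 1) (hx : 1 ≤ x) (hx' : 1 ≤ x') (hy : 1 ≤ y) (hy' : 1 ≤ y')
    (hxn : x ≤ n) (hyn : y ≤ n) (hxn' : x' ≤ n) (hyn' : y' ≤ n)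
    (h1 : n ∣ x' + L * x) (h2 : n ∣ y' + L * y)
    (hxy : x * y < n - L) (hxy' : x' * y' < n - L) : False := by
  have h1' := dvd_add_mul_of_dvd hn h1
  have h2' := dvd_add_mul_of_dvd hn h2
  have hn4 : 4 * (L * L) - 1 ≤ n := by nlinarith
  have hyhalf : ¬ n ≤ 2 * y' :=
    fun h => not_dvd_of_half_le hL hM hn hx hx' hy hy' hxn h1' h2 hxy hxy' h
  have hxhalf : ¬ n ≤ 2 * x' := fun h => not_dvd_of_half_le hL hM hn hy hy' hx hx' hyn h2' h1
    (by linarith [mul_comm x y]) (by linarith [mul_comm x' y']) h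
  rcases lt_or_ge x M with hxM | hxM <;> rcases lt_or_ge y M with hyM | hyM
  · have e1 := eq_sub_of_dvd hL hn hx hx' hxn' h1 hxM
    have e2 := eq_sub_of_dvd hL hn hy hy' hyn' h2 hyM
    have g1 : M ≤ 2 * x := by
      by_contra hc
      have : L * (2 * x) ≤ L * (M - 1) := mul_le_mul_of_nonneg_left (by omega) (by omega)
      nlinarith
    have g2 : M ≤ 2 * y := by
      by_contra hc
      have : L * (2 * y) ≤ L * (M - 1) := mul_le_mul_of_nonneg_left (by omega) (by omega)
      nlinarith
    have : M * M ≤ (2 * x) * (2 * y) := mul_le_mul g1 g2 (by omega) (by omega)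
    nlinarith
  · have e1 := eq_sub_of_dvd hL hn hx hx' hxn' h1 hxM
    have : x < L := by
      by_contra hc
      have : L * M ≤ x * y := mul_le_mul (by omega) hyM (by omega) (by omega)
      nlinarith
    have : L * x ≤ L * (L - 1) := mul_le_mul_of_nonneg_left (by omega) (by omega)
    nlinarith
  · have e2 := eq_sub_of_dvd hL hn hy hy' hyn' h2 hyM
    have : y < L := by
      by_contra hc
      have : M * L ≤ x * y := mul_le_mul hxM (by omega) (by omega) (by omega)
      nlinarith
    have : L * y ≤ L * (L - 1) := mul_le_mul_of_nonneg_left (by omega) (by omega)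
    nlinarith
  · have : M * M ≤ x * y := mul_le_mul hxM hyM (by omega) (by omega)
    nlinarith

/-- With `y = N - w` and `x' = N - s`, the two products are `(N s - 1) (N - w)` and
`(N w - 1) (N - s)`; the larger one is at least `(N - 1)²` because `t (N - t) ≥ N - 1` for
`1 ≤ t ≤ N - 1`. -/
theorem not_dvd_of_lt_of_lt {N n x y x' y' : ℤ} (hN : 2 ≤ N) (hn : n = N * N - 1)
    (hx : 1 ≤ x) (hx' : 1 ≤ x') (hy : 1 ≤ y) (hy' : 1 ≤ y')
    (hxn : x ≤ n) (hyn' : y' ≤ n)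
    (h1 : n ∣ x + N * x') (h2 : n ∣ y' + N * y)
    (hxy : x * y < (N - 1) ^ 2) (hxy' : x' * y' < (N - 1) ^ 2)
    (hyN : y < N) (hxN : x' < N) : False := by
  have e1 := eq_sub_of_dvd hN hn hx' hx hxn h1 hxN
  have e2 := eq_sub_of_dvd hN hn hy hy' hyn' h2 hyN
  obtain ⟨w, rfl⟩ : ∃ w, y = N - w := ⟨N - y, by ring⟩
  obtain ⟨s, rfl⟩ : ∃ s, x' = N - s := ⟨N - x', by ring⟩
  have e1' : x = N * s - 1 := by rw [e1, hn]; ring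
  have e2' : y' = N * w - 1 := by rw [e2, hn]; ring
  subst e1' e2'
  rcases le_total s w with h | h
  · have k1 : N - 1 ≤ w * (N - w) := by
      nlinarith [mul_nonneg (show 0 ≤ w - 1 by omega) (show 0 ≤ N - w - 1 by omega)]
    have k2 : w * (N - w) ≤ w * (N - s) := mul_le_mul_of_nonneg_left (by omega) (by omega)
    have : N * (N - 1) ≤ N * (w * (N - s)) := mul_le_mul_of_nonneg_left (by omega) (by omega)
    nlinarith
  · have k1 : N - 1 ≤ s * (N - s) := by
      nlinarith [mul_nonneg (show 0 ≤ s - 1 by omega) (show 0 ≤ N - s - 1 by omega)]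
    have k2 : s * (N - s) ≤ s * (N - w) := mul_le_mul_of_nonneg_left (by omega) (by omega)
    have : N * (N - 1) ≤ N * (s * (N - w)) := mul_le_mul_of_nonneg_left (by omega) (by omega)
    nlinarith

/-- The two congruences with `L = M = N`; the bound `(N - 1)²` is attained at
`x = y = x' = y' = N - 1`. -/
theorem not_dvd_of_sq {N n x y x' y' : ℤ} (hN : 2 ≤ N)
    (hn : n = N * N - 1) (hx : 1 ≤ x) (hx' : 1 ≤ x') (hy : 1 ≤ y) (hy' : 1 ≤ y')
    (hxn : x ≤ n) (hyn : y ≤ n) (hxn' : x' ≤ n) (hyn' : y' ≤ n)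
    (h1 : n ∣ x' + N * x) (h2 : n ∣ y' + N * y)
    (hxy : x * y < (N - 1) ^ 2) (hxy' : x' * y' < (N - 1) ^ 2) : False := by
  have h1' := dvd_add_mul_of_dvd hn h1
  have h2' := dvd_add_mul_of_dvd hn h2
  have A : ¬ (y < N ∧ x' < N) := fun h =>
    not_dvd_of_lt_of_lt hN hn hx hx' hy hy' hxn hyn' h1' h2 hxy hxy' h.1 h.2
  have B : ¬ (x < N ∧ y' < N) := fun h =>
    not_dvd_of_lt_of_lt hN hn hy hy' hx hx' hyn hxn' h2' h1
      (by linarith [mul_comm x y]) (by linarith [mul_comm x' y']) h.1 h.2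
  have Cc : ∀ a b : ℤ, N ≤ a → N - 1 ≤ b → ¬ a * b < (N - 1) ^ 2 := by
    intro a b ha hb h
    have : N * (N - 1) ≤ a * b := mul_le_mul ha hb (by omega) (by omega)
    nlinarith
  have D : ∀ a a' : ℤ, 1 ≤ a → 1 ≤ a' → a' ≤ n → n ∣ a' + N * a → a < N → a' < N → a = N - 1 := by
    intro a a' ha ha' han h haN haN'
    have := eq_sub_of_dvd hN hn ha ha' han h haN
    by_contra hc
    have : N * a ≤ N * (N - 2) := mul_le_mul_of_nonneg_left (by omega) (by omega)
    nlinarith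
  rcases lt_or_ge x N with hxN | hxN <;> rcases lt_or_ge y N with hyN | hyN
  · rcases lt_or_ge x' N with h | h
    · exact A ⟨hyN, h⟩
    · rcases lt_or_ge y' N with h3 | h3
      · exact B ⟨hxN, h3⟩
      · exact Cc _ _ h (by omega) hxy'
  · rcases lt_or_ge x' N with h | h
    · exact Cc y x hyN (D x x' hx hx' hxn' h1 hxN h).ge (by linarith [mul_comm x y])
    · rcases lt_or_ge y' N with h3 | h3
      · exact B ⟨hxN, h3⟩
      · exact Cc _ _ h (by omega) hxy'
  · rcases lt_or_ge x' N with h | h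
    · exact A ⟨hyN, h⟩
    · rcases lt_or_ge y' N with h3 | h3
      · exact Cc x y hxN (D y y' hy hy' hyn' h2 hyN h3).ge hxy
      · exact Cc _ _ h (by omega) hxy'
  · exact Cc _ _ hxN (by omega) hxy

theorem deltaH_cast_odd {q m : ℕ} (hq : 2 ≤ q) (hm : Odd m) :
    (deltaH q m : ℤ) = ((q : ℤ) ^ m - 1) ^ 2 := by
  have : 1 ≤ q ^ m := Nat.one_le_pow _ _ (by omega)
  simp [deltaH, hm, Nat.cast_sub this]

theorem deltaH_add_pow_le {q m l : ℕ} (hq : 2 ≤ q) (hl : l < m) :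
    deltaH q m + q ^ l ≤ q ^ (2 * m) - 1 := by
  have h1 : q ^ l ≤ q ^ (m - 1) := Nat.pow_le_pow_right (by omega) (by omega)
  have h0 : 1 ≤ q ^ (m - 1) := Nat.one_le_pow _ _ (by omega)
  have h2 : q ^ m = q * q ^ (m - 1) := by rw [← pow_succ']; congr 1; omega
  have h2' : 2 * q ^ (m - 1) ≤ q ^ m := h2 ▸ Nat.mul_le_mul_right _ hq
  have h3 : q ^ (2 * m) = q ^ m * q ^ m := by rw [two_mul, pow_add]
  unfold deltaH
  split_ifs
  · obtain ⟨t, ht⟩ : ∃ t, q ^ m = t + 1 := ⟨q ^ m - 1, by omega⟩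
    have h4 : q ^ (2 * m) - 1 = t ^ 2 + 2 * t := by
      rw [h3, ht]; have : (t + 1) * (t + 1) = t ^ 2 + 2 * t + 1 := by ring
      omega
    rw [h4, ht, Nat.add_sub_cancel]
    omega
  · have : q ^ m ≤ q ^ (2 * m) := Nat.pow_le_pow_right (by omega) (by omega)
    omega

theorem not_dvd_of_odd_of_le {q m l x y x' y' : ℕ} (hq : 2 ≤ q) (hl : Odd l) (hlm : l ≤ m)
    (hx : 1 ≤ x) (hx' : 1 ≤ x') (hy : 1 ≤ y) (hy' : 1 ≤ y')
    (hxn : x ≤ q ^ (2 * m) - 1) (hyn : y ≤ q ^ (2 * m) - 1)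
    (hxn' : x' ≤ q ^ (2 * m) - 1) (hyn' : y' ≤ q ^ (2 * m) - 1)
    (hxy : x * y < deltaH q m) (hxy' : x' * y' < deltaH q m)
    (h1 : q ^ (2 * m) - 1 ∣ x' + q ^ l * x) (h2 : q ^ (2 * m) - 1 ∣ y' + q ^ l * y) : False := by
  have hpos : 1 ≤ q ^ (2 * m) := Nat.one_le_pow _ _ (by omega)
  have hL : 2 ≤ q ^ l := hq.trans (Nat.le_self_pow hl.pos.ne' q)
  zify [hpos] at h1 h2 hxn hyn hxn' hyn' hx hx' hy hy' hL hxy hxy'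
  rcases hlm.lt_or_eq with h | rfl
  · have hM : 4 * q ^ l ≤ q ^ (2 * m - l) := by
      have : q ^ (2 * m - l) = q ^ (2 * m - 2 * l) * q ^ l := by rw [← pow_add]; congr 1; omega
      rw [this]
      apply Nat.mul_le_mul_right
      calc 4 ≤ q ^ 2 := by nlinarith
        _ ≤ _ := Nat.pow_le_pow_right (by omega) (by omega)
    have hn : (q : ℤ) ^ (2 * m) - 1 = q ^ l * q ^ (2 * m - l) - 1 := by
      rw [← pow_add]; congr 2; omega
    have hd := deltaH_add_pow_le hq h
    zify [hpos] at hM hd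
    exact not_dvd_of_four_mul_le hL hM hn hx hx' hy hy' hxn hyn hxn' hyn' h1 h2
      (by linarith) (by linarith)
  · rw [deltaH_cast_odd hq hl] at hxy hxy'
    exact not_dvd_of_sq hL (by rw [two_mul, pow_add]) hx hx' hy hy' hxn hyn hxn' hyn' h1 h2
      hxy hxy'

/-- The cosets of the points under the hyperbola `x y < δ_h` are disjoint from their images under
multiplication by `-q`. Since `q ^ (2 m) ≡ 1` modulo `n`, the exponent `j` only matters modulo
`2 m`, and `j` may be replaced by `-j` when the two points are exchanged. -/
theorem not_dvd_of_odd {q m j x y x' y' : ℕ} (hq : 2 ≤ q) (hm : 0 < m) (hj : Odd j)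
    (hx : 1 ≤ x) (hx' : 1 ≤ x') (hy : 1 ≤ y) (hy' : 1 ≤ y')
    (hxn : x ≤ q ^ (2 * m) - 1) (hyn : y ≤ q ^ (2 * m) - 1)
    (hxn' : x' ≤ q ^ (2 * m) - 1) (hyn' : y' ≤ q ^ (2 * m) - 1)
    (hxy : x * y < deltaH q m) (hxy' : x' * y' < deltaH q m)
    (h1 : q ^ (2 * m) - 1 ∣ x' + q ^ j * x) (h2 : q ^ (2 * m) - 1 ∣ y' + q ^ j * y) : False := by
  have hpos : 1 ≤ q ^ (2 * m) := Nat.one_le_pow _ _ (by omega)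
  have hone : q ^ (2 * m) ≡ 1 [MOD q ^ (2 * m) - 1] := by
    simpa using (Nat.modEq_iff_dvd' hpos).2 dvd_rfl |>.symm
  have hmod : ∀ i, q ^ i ≡ q ^ (i % (2 * m)) [MOD q ^ (2 * m) - 1] := by
    intro i
    conv_lhs => rw [← Nat.div_add_mod i (2 * m), pow_add, pow_mul]
    simpa using (hone.pow (i / (2 * m))).mul_right (q ^ (i % (2 * m)))
  have hl : Odd (j % (2 * m)) := by
    rw [Nat.odd_iff, Nat.mod_mul_right_mod]; exact Nat.odd_iff.1 hj
  have hlt : j % (2 * m) < 2 * m := Nat.mod_lt _ (by omega)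
  have red : ∀ {a b : ℕ}, q ^ (2 * m) - 1 ∣ b + q ^ j * a →
      q ^ (2 * m) - 1 ∣ b + q ^ (j % (2 * m)) * a := fun {a b} h =>
    (((hmod j).mul_right a).add_left b).dvd_iff dvd_rfl |>.1 h
  rcases le_or_gt (j % (2 * m)) m with h | h
  · exact not_dvd_of_odd_of_le hq hl h hx hx' hy hy' hxn hyn hxn' hyn' hxy hxy' (red h1) (red h2)
  · have swap : ∀ {a b : ℕ}, q ^ (2 * m) - 1 ∣ b + q ^ (j % (2 * m)) * a →
        q ^ (2 * m) - 1 ∣ a + q ^ (2 * m - j % (2 * m)) * b := by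
      intro a b hab
      have e : q ^ (2 * m - j % (2 * m)) * (b + q ^ (j % (2 * m)) * a)
          = q ^ (2 * m) * a + q ^ (2 * m - j % (2 * m)) * b := by
        rw [mul_add, ← mul_assoc, ← pow_add, Nat.sub_add_cancel hlt.le]; ring
      have h3 := e ▸ hab.mul_left (q ^ (2 * m - j % (2 * m)))
      refine (Nat.ModEq.dvd_iff ?_ dvd_rfl).1 h3
      simpa using (hone.mul_right a).add_right (q ^ (2 * m - j % (2 * m)) * b)
    have hl' : Odd (2 * m - j % (2 * m)) := by
      rw [Nat.odd_iff] at hl ⊢; omega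
    exact not_dvd_of_odd_of_le hq hl' (by omega) hx' hx hy' hy hxn' hyn' hxn hyn
      hxy' hxy (swap (red h1)) (swap (red h2))

/-! ### Discrete Fourier transform of arrays -/

section Fourier

variable {L : Type*} [Field L] {n : ℕ} {α : L}

theorem IsPrimitiveRoot.pow_eq_pow_of_modEq (hα : IsPrimitiveRoot α n) {a b : ℕ}
    (h : a ≡ b [MOD n]) : α ^ a = α ^ b := by
  rw [← Nat.mod_add_div a n, ← Nat.mod_add_div b n, h, pow_add, pow_add, pow_mul, pow_mul,
    hα.pow_eq_one, one_pow, one_pow]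

theorem sum_pow_mul_inv_pow (hα : IsPrimitiveRoot α n) (a b : ℕ) :
    ∑ i : Fin n, (α ^ a) ^ (i : ℕ) * ((α ^ b)⁻¹) ^ (i : ℕ) =
      if a ≡ b [MOD n] then (n : L) else 0 := by
  rcases Nat.eq_zero_or_pos n with rfl | hn
  · simp
  have hα0 : α ≠ 0 := hα.ne_zero hn.ne'
  have hiff : α ^ a = α ^ b ↔ a ≡ b [MOD n] := by
    rw [(hα.isUnit hn.ne').unit_spec.symm, ← Units.val_pow_eq_pow_val, ← Units.val_pow_eq_pow_val,
      Units.val_inj, pow_eq_pow_iff_modEq, ← orderOf_units, IsUnit.unit_spec, ← hα.eq_orderOf]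
  simp_rw [← mul_pow]
  rw [Fin.sum_univ_eq_sum_range (fun i => (α ^ a * (α ^ b)⁻¹) ^ i) n]
  split_ifs with h
  · rw [hiff.2 h, mul_inv_cancel₀ (pow_ne_zero _ hα0)]; simp
  · have h1 : α ^ a * (α ^ b)⁻¹ - 1 ≠ 0 := by
      rw [sub_ne_zero, Ne, mul_inv_eq_one₀ (pow_ne_zero _ hα0), hiff]; exact h
    refine (mul_eq_zero.1 ?_).resolve_left h1
    rw [mul_geom_sum, mul_pow, inv_pow, ← pow_mul, ← pow_mul, mul_comm a, mul_comm b, pow_mul,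
      pow_mul, hα.pow_eq_one]
    simp

/-- The inverse Fourier transform, up to the factor `n²`, of the indicator function of `T`. -/
def indicatorArray (α : L) (T : Finset (Fin n × Fin n)) (ij : Fin n × Fin n) : L :=
  ∑ z ∈ T, ((α ^ (z.1 : ℕ))⁻¹) ^ (ij.1 : ℕ) * ((α ^ (z.2 : ℕ))⁻¹) ^ (ij.2 : ℕ)

/-- Orthogonality of the characters `(i, j) ↦ α ^ (a i + b j)` of the grid. -/
theorem sum_character_mul_inv (hα : IsPrimitiveRoot α n) (a b a' b' : ℕ) :
    ∑ ij : Fin n × Fin n, ((α ^ a') ^ (ij.1 : ℕ) * (α ^ b') ^ (ij.2 : ℕ)) *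
      (((α ^ a)⁻¹) ^ (ij.1 : ℕ) * ((α ^ b)⁻¹) ^ (ij.2 : ℕ)) =
      if a' ≡ a [MOD n] ∧ b' ≡ b [MOD n] then (n : L) ^ 2 else 0 := by
  have : ∀ ij : Fin n × Fin n, ((α ^ a') ^ (ij.1 : ℕ) * (α ^ b') ^ (ij.2 : ℕ)) *
      (((α ^ a)⁻¹) ^ (ij.1 : ℕ) * ((α ^ b)⁻¹) ^ (ij.2 : ℕ)) =
      ((α ^ a') ^ (ij.1 : ℕ) * ((α ^ a)⁻¹) ^ (ij.1 : ℕ)) *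
      ((α ^ b') ^ (ij.2 : ℕ) * ((α ^ b)⁻¹) ^ (ij.2 : ℕ)) := fun ij => by ring
  simp_rw [this]
  rw [Fintype.sum_prod_type]
  dsimp only
  rw [← Fintype.sum_mul_sum, sum_pow_mul_inv_pow hα,
    sum_pow_mul_inv_pow hα]
  by_cases h : a' ≡ a [MOD n] <;> by_cases h' : b' ≡ b [MOD n] <;> simp [h, h', sq]

theorem Fin.modEq_iff_eq (i j : Fin n) : (i : ℕ) ≡ j [MOD n] ↔ i = j :=
  ⟨fun h => Fin.ext (h.eq_of_lt_of_lt i.2 j.2), fun h => h ▸ rfl⟩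

theorem codePolyEval_self (c : Fin n × Fin n → L) (X Y : L) :
    codePolyEval c X Y = ∑ ij, c ij * (X ^ (ij.1 : ℕ) * Y ^ (ij.2 : ℕ)) := by
  simp [codePolyEval, mul_assoc]

theorem codePolyEval_indicatorArray (hα : IsPrimitiveRoot α n) (T : Finset (Fin n × Fin n))
    (w : Fin n × Fin n) :
    codePolyEval (indicatorArray α T) (α ^ (w.1 : ℕ)) (α ^ (w.2 : ℕ)) =
      if w ∈ T then (n : L) ^ 2 else 0 := by
  classical
  rw [codePolyEval_self]
  simp_rw [indicatorArray, Finset.sum_mul]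
  rw [Finset.sum_comm]
  simp_rw [mul_comm _ ((α ^ (w.1 : ℕ)) ^ _ * _), sum_character_mul_inv hα, Fin.modEq_iff_eq,
    ← Prod.ext_iff]
  simp

/-- Injectivity of the Fourier transform. -/
theorem eq_zero_of_codePolyEval_eq_zero (hα : IsPrimitiveRoot α n) (hn : (n : L) ≠ 0)
    {c : Fin n × Fin n → L}
    (h : ∀ w : Fin n × Fin n, codePolyEval c (α ^ (w.1 : ℕ)) (α ^ (w.2 : ℕ)) = 0) : c = 0 := by
  classical
  funext v
  have key : ∑ w : Fin n × Fin n, codePolyEval c (α ^ (w.1 : ℕ)) (α ^ (w.2 : ℕ)) *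
      (((α ^ (v.1 : ℕ))⁻¹) ^ (w.1 : ℕ) * ((α ^ (v.2 : ℕ))⁻¹) ^ (w.2 : ℕ)) = c v * (n : L) ^ 2 := by
    simp_rw [codePolyEval_self, Finset.sum_mul]
    rw [Finset.sum_comm]
    have e : ∀ y x : Fin n × Fin n, c y * ((α ^ (x.1 : ℕ)) ^ (y.1 : ℕ) *
        (α ^ (x.2 : ℕ)) ^ (y.2 : ℕ)) *
        (((α ^ (v.1 : ℕ))⁻¹) ^ (x.1 : ℕ) * ((α ^ (v.2 : ℕ))⁻¹) ^ (x.2 : ℕ)) =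
        c y * (((α ^ (y.1 : ℕ)) ^ (x.1 : ℕ) * (α ^ (y.2 : ℕ)) ^ (x.2 : ℕ)) *
        (((α ^ (v.1 : ℕ))⁻¹) ^ (x.1 : ℕ) * ((α ^ (v.2 : ℕ))⁻¹) ^ (x.2 : ℕ))) := by
      intro y x
      rw [pow_right_comm, pow_right_comm α (x.2 : ℕ), mul_assoc]
    simp_rw [e, ← Finset.mul_sum, sum_character_mul_inv hα, Fin.modEq_iff_eq, ← Prod.ext_iff]
    simp
  simp_rw [h, zero_mul, Finset.sum_const_zero] at key
  exact (mul_eq_zero.1 key.symm).resolve_right (pow_ne_zero _ hn)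

/-- In an extension of a finite field `K`, the elements fixed by the Frobenius lie in `K`: they are
roots of `X ^ |K| - X`, which the elements of `K` exhaust. -/
theorem exists_algebraMap_eq_of_pow_card_eq {K : Type*} [Field K] [Fintype K] [Algebra K L] {x : L}
    (hx : x ^ Fintype.card K = x) : ∃ a : K, algebraMap K L a = x := by
  classical
  by_contra! hne
  have h1 : 1 < Fintype.card K := Fintype.one_lt_card
  have hle := Polynomial.card_le_degree_of_subset_roots
    (p := (Polynomial.X ^ Fintype.card K - Polynomial.X : Polynomial L))
    (Z := insert x (Finset.univ.image (algebraMap K L))) (fun y hy => by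
      rw [Polynomial.mem_roots (FiniteField.X_pow_card_sub_X_ne_zero L h1)]
      suffices y ^ Fintype.card K = y by simp [this]
      rcases Finset.mem_insert.1 hy with rfl | hy
      · exact hx
      · obtain ⟨a, -, rfl⟩ := Finset.mem_image.1 hy
        rw [← map_pow, FiniteField.pow_card])
  rw [FiniteField.X_pow_card_sub_X_natDegree_eq L h1,
    Finset.card_insert_of_notMem (by simpa using hne),
    Finset.card_image_of_injective _ (algebraMap K L).injective, Finset.card_univ] at hle
  omega

variable {K : Type*} [Field K] [Fintype K] [Algebra K L]

/-- The inverse transform of the indicator of a set stable under multiplication by `|K|` is fixed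
by the Frobenius, hence has entries in `K`. -/
theorem exists_algebraMap_eq_indicatorArray (hα : IsPrimitiveRoot α n)
    {T : Finset (Fin n × Fin n)} (f : Fin n × Fin n → Fin n × Fin n) (hf : Set.BijOn f T T)
    (hf₁ : ∀ z, ((f z).1 : ℕ) ≡ z.1 * Fintype.card K [MOD n])
    (hf₂ : ∀ z, ((f z).2 : ℕ) ≡ z.2 * Fintype.card K [MOD n]) :
    ∃ e : Fin n × Fin n → K, ∀ ij, algebraMap K L (e ij) = indicatorArray α T ij := by
  suffices h : ∀ ij, ∃ a : K, algebraMap K L a = indicatorArray α T ij from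
    ⟨fun ij => (h ij).choose, fun ij => (h ij).choose_spec⟩
  intro ij
  apply exists_algebraMap_eq_of_pow_card_eq
  change FiniteField.frobeniusAlgHom K L _ = _
  rw [indicatorArray, map_sum]
  refine Finset.sum_bij (fun z _ => f z) (fun z hz => hf.mapsTo hz)
    (fun a ha b hb h => hf.injOn ha hb h) (fun b hb => ?_) fun z _ => ?_
  · obtain ⟨a, ha, h⟩ := hf.surjOn hb
    exact ⟨a, ha, h⟩
  · rw [FiniteField.coe_frobeniusAlgHom, hα.pow_eq_pow_of_modEq (hf₁ z),
      hα.pow_eq_pow_of_modEq (hf₂ z)]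
    simp only [mul_pow, pow_mul, inv_pow]
    rw [pow_right_comm, pow_right_comm (α ^ (z.2 : ℕ))]

end Fourier

/-! ### Bicyclic codes with prescribed zeros -/

section ZeroCode

variable {K : Type*} [Field K] {L : Type*} [Field L] [Algebra K L] {n : ℕ} {α : L}

/-- The code of all arrays whose code polynomials vanish at the points `(α ^ x, α ^ y)` for
`(x, y) ∈ Z`. -/
def zeroCode (K : Type*) [Field K] [Algebra K L] (n : ℕ) (α : L) (Z : Set (ℕ × ℕ)) :
    Submodule K (Fin n × Fin n → K) where
  carrier := {c | ∀ z ∈ Z, codePolyEval c (α ^ z.1) (α ^ z.2) = 0}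
  zero_mem' := by intro z _; simp [codePolyEval]
  add_mem' {a b} ha hb := by
    intro z hz
    have : codePolyEval (a + b) (α ^ z.1) (α ^ z.2) =
        codePolyEval a (α ^ z.1) (α ^ z.2) + codePolyEval b (α ^ z.1) (α ^ z.2) := by
      simp [codePolyEval, add_mul, Finset.sum_add_distrib]
    rw [this, ha z hz, hb z hz, add_zero]
  smul_mem' r a ha := by
    intro z hz
    have : codePolyEval (r • a) (α ^ z.1) (α ^ z.2) =
        algebraMap K L r * codePolyEval a (α ^ z.1) (α ^ z.2) := by
      simp [codePolyEval, mul_assoc, Finset.mul_sum]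
    rw [this, ha z hz, mul_zero]

theorem mem_zeroCode {Z : Set (ℕ × ℕ)} {c : Fin n × Fin n → K} :
    c ∈ zeroCode K n α Z ↔ ∀ z ∈ Z, codePolyEval c (α ^ z.1) (α ^ z.2) = 0 := Iff.rfl

theorem codePolyEval_algebraMap (c : Fin n × Fin n → K) (X Y : L) :
    codePolyEval (fun ij => algebraMap K L (c ij)) X Y = codePolyEval c X Y := by
  simp [codePolyEval]

theorem pow_val_add [NeZero n] {X : L} (hX : X ^ n = 1) (i s : Fin n) :
    X ^ ((i + s : Fin n) : ℕ) = X ^ (i : ℕ) * X ^ (s : ℕ) := by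
  rw [Fin.val_add, ← pow_add]
  conv_rhs => rw [← Nat.mod_add_div ((i : ℕ) + s) n, pow_add, pow_mul, hX, one_pow, mul_one]

theorem codePolyEval_translate [NeZero n] (c : Fin n × Fin n → K) {X Y : L} (hX : X ^ n = 1)
    (hY : Y ^ n = 1) (s : Fin n × Fin n) :
    codePolyEval (fun ij => c (ij - s)) X Y =
      X ^ (s.1 : ℕ) * Y ^ (s.2 : ℕ) * codePolyEval c X Y := by
  unfold codePolyEval
  rw [← Equiv.sum_comp (Equiv.addRight s), Finset.mul_sum]
  refine Finset.sum_congr rfl fun ij _ => ?_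
  simp only [Equiv.coe_addRight, add_sub_cancel_right, Prod.fst_add, Prod.snd_add,
    pow_val_add hX, pow_val_add hY]
  ring

theorem translate_mem_zeroCode [NeZero n] (hα : α ^ n = 1) {Z : Set (ℕ × ℕ)}
    {c : Fin n × Fin n → K} (hc : c ∈ zeroCode K n α Z) (s : Fin n × Fin n) :
    (fun ij => c (ij - s)) ∈ zeroCode K n α Z := by
  intro z hz
  rw [codePolyEval_translate, hc z hz, mul_zero] <;> rw [pow_right_comm, hα, one_pow]

theorem isBicyclic_zeroCode [Fintype K] [NeZero n] (hα : α ^ n = 1)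
    (hn : Nat.Coprime n (Fintype.card K)) (Z : Set (ℕ × ℕ)) : IsBicyclic (zeroCode K n α Z) where
  coprime := hn.mul_left hn
  shift_columns c hc := by
    simpa [finRotate_symm_apply, Prod.sub_def] using translate_mem_zeroCode hα hc (0, 1)
  shift_rows c hc := by
    simpa [finRotate_symm_apply, Prod.sub_def] using translate_mem_zeroCode hα hc (1, 0)

/-- The exponents in `Fin n × Fin n` outside `Z`. -/
noncomputable def nonzeros (n : ℕ) (Z : Set (ℕ × ℕ)) : Finset (Fin n × Fin n) :=
  open Classical in Finset.univ.filter fun z => ((z.1 : ℕ), (z.2 : ℕ)) ∉ Z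

theorem mem_nonzeros {Z : Set (ℕ × ℕ)} {z : Fin n × Fin n} :
    z ∈ nonzeros n Z ↔ ((z.1 : ℕ), (z.2 : ℕ)) ∉ Z := by
  simp [nonzeros]

/-- A set of exponents stable under multiplication by `|K|` is the exact set of zeros of an
array over `K`. -/
theorem exists_generator [Fintype K] [NeZero n] (hα : IsPrimitiveRoot α n)
    (hn : Nat.Coprime n (Fintype.card K)) {Z : Set (ℕ × ℕ)}
    (hQ : ∀ x y, x < n → y < n →
      ((x * Fintype.card K % n, y * Fintype.card K % n) ∈ Z ↔ (x, y) ∈ Z)) :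
    ∃ e : Fin n × Fin n → K, ∀ ij, algebraMap K L (e ij) = indicatorArray α (nonzeros n Z) ij := by
  have hpos : 0 < n := NeZero.pos n
  let f : Fin n × Fin n → Fin n × Fin n := fun z =>
    (⟨z.1 * Fintype.card K % n, Nat.mod_lt _ hpos⟩, ⟨z.2 * Fintype.card K % n, Nat.mod_lt _ hpos⟩)
  have hmaps : Set.MapsTo f (nonzeros n Z : Set (Fin n × Fin n)) (nonzeros n Z) := by
    intro z hz
    rw [Finset.mem_coe, mem_nonzeros] at hz ⊢
    rwa [hQ _ _ z.1.2 z.2.2]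
  have hinj1 : ∀ a b : Fin n, (a : ℕ) * Fintype.card K % n = b * Fintype.card K % n → a = b :=
    fun a b h => (Fin.modEq_iff_eq a b).1 (Nat.ModEq.cancel_right_of_coprime hn h)
  have hinj : Function.Injective f := by
    intro a b h
    simp only [f, Prod.mk.injEq, Fin.mk.injEq] at h
    exact Prod.ext (hinj1 _ _ h.1) (hinj1 _ _ h.2)
  refine exists_algebraMap_eq_indicatorArray hα f
    (((nonzeros n Z).finite_toSet.injOn_iff_bijOn_of_mapsTo hmaps).1 hinj.injOn) ?_ ?_
  · intro z; exact Nat.mod_modEq _ _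
  · intro z; exact Nat.mod_modEq _ _

theorem definingSet_zeroCode [Fintype K] [NeZero n] (hα : IsPrimitiveRoot α n)
    (hn : Nat.Coprime n (Fintype.card K)) {Z : Set (ℕ × ℕ)} (hn0 : (n : L) ≠ 0)
    (hZ : ∀ z ∈ Z, z.1 < n ∧ z.2 < n)
    (hQ : ∀ x y, x < n → y < n →
      ((x * Fintype.card K % n, y * Fintype.card K % n) ∈ Z ↔ (x, y) ∈ Z)) :
    definingSet α α (zeroCode K n α Z) = Z := by
  obtain ⟨e, he⟩ := exists_generator hα hn hQ
  have he' : ∀ w : Fin n × Fin n, codePolyEval e (α ^ (w.1 : ℕ)) (α ^ (w.2 : ℕ)) =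
      if w ∈ nonzeros n Z then (n : L) ^ 2 else 0 := by
    intro w
    rw [← codePolyEval_algebraMap, funext he, codePolyEval_indicatorArray hα]
  ext z
  refine ⟨fun ⟨h1, h2, h⟩ => ?_, fun hz => ⟨(hZ z hz).1, (hZ z hz).2, fun c hc => hc z hz⟩⟩
  by_contra hz
  have hmem : e ∈ zeroCode K n α Z := by
    intro w hw
    rw [he' (⟨w.1, (hZ w hw).1⟩, ⟨w.2, (hZ w hw).2⟩), if_neg]
    rwa [mem_nonzeros, not_not]
  have := h e hmem
  rw [he' (⟨z.1, h1⟩, ⟨z.2, h2⟩), if_pos (mem_nonzeros.2 hz)] at this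
  exact pow_ne_zero _ hn0 this

/-- If no `-|F| z` with `z ∈ Z` lies in `Z`, the code contains its Hermitian dual. An array
orthogonal to all translates of the generator has, by injectivity of the Fourier transform,
vanishing conjugate transform at all `-w` with `w ∉ Z`. -/
theorem hermitianDual_zeroCode_subset {F : Type*} [Field F] [Fintype F] [Algebra F L]
    [Fintype K] [NeZero n] (hα : IsPrimitiveRoot α n)
    (hn : Nat.Coprime n (Fintype.card K)) {Z : Set (ℕ × ℕ)} (hn0 : (n : L) ≠ 0)
    (hZ : ∀ z ∈ Z, z.1 < n ∧ z.2 < n)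
    (hQ : ∀ x y, x < n → y < n →
      ((x * Fintype.card K % n, y * Fintype.card K % n) ∈ Z ↔ (x, y) ∈ Z))
    (hneg : ∀ z ∈ Z, ∀ w ∈ Z, n ∣ w.1 + Fintype.card F * z.1 → ¬ n ∣ w.2 + Fintype.card F * z.2) :
    hermitianDual F (zeroCode K n α Z) ⊆ (zeroCode K n α Z : Set (Fin n × Fin n → K)) := by
  classical
  have hpos : 0 < n := NeZero.pos n
  have hα0 : α ≠ 0 := hα.ne_zero hpos.ne'
  obtain ⟨e, he⟩ := exists_generator hα hn hQ
  have he' : e ∈ zeroCode K n α Z := by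
    intro w hw
    rw [← codePolyEval_algebraMap, funext he]
    have := codePolyEval_indicatorArray hα (nonzeros n Z) (⟨w.1, (hZ w hw).1⟩, ⟨w.2, (hZ w hw).2⟩)
    rw [if_neg (by rwa [mem_nonzeros, not_not])] at this
    exact this
  have hinv : ∀ (k : ℕ) (i s : Fin n), ((α ^ k)⁻¹) ^ ((i - s : Fin n) : ℕ) =
      ((α ^ k)⁻¹) ^ (i : ℕ) * (α ^ (s : ℕ)) ^ k := by
    intro k i s
    have h1 : ((α ^ k)⁻¹) ^ n = 1 := by rw [inv_pow, pow_right_comm, hα.pow_eq_one]; simp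
    have h2 := pow_val_add h1 (i - s) s
    rw [sub_add_cancel] at h2
    rw [h2, mul_assoc, pow_right_comm α s k, ← mul_pow, inv_mul_cancel₀ (pow_ne_zero _ hα0),
      one_pow, mul_one]
  intro u hu z hz
  let q := Fintype.card F
  -- the transform of the conjugate of `u` at `-w`
  let S : Fin n × Fin n → L := fun w => ∑ ij : Fin n × Fin n, algebraMap K L (u ij ^ q) *
    (((α ^ (w.1 : ℕ))⁻¹) ^ (ij.1 : ℕ) * ((α ^ (w.2 : ℕ))⁻¹) ^ (ij.2 : ℕ))
  have hS : (fun w => if w ∈ nonzeros n Z then S w else 0) = 0 := by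
    refine eq_zero_of_codePolyEval_eq_zero hα hn0 fun s => ?_
    have h0 := congrArg (algebraMap K L) (hu _ (translate_mem_zeroCode hα.pow_eq_one he' s))
    rw [map_sum, map_zero] at h0
    simp_rw [map_mul, he, indicatorArray, Prod.fst_sub, Prod.snd_sub, hinv, Finset.mul_sum] at h0
    rw [Finset.sum_comm] at h0
    refine Eq.trans ?_ h0
    simp only [codePolyEval_self, ite_mul, zero_mul]
    rw [Finset.sum_ite_mem, Finset.univ_inter]
    refine Finset.sum_congr rfl fun w _ => ?_
    simp only [S, Finset.sum_mul]
    refine Finset.sum_congr rfl fun ij _ => ?_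
    ring
  -- `w` represents `-q z`
  let w : Fin n × Fin n := (⟨(n - q * z.1 % n) % n, Nat.mod_lt _ hpos⟩,
    ⟨(n - q * z.2 % n) % n, Nat.mod_lt _ hpos⟩)
  have hdvd : ∀ a : ℕ, n ∣ (n - a % n) % n + a := by
    intro a
    rw [← Nat.modEq_zero_iff_dvd]
    calc (n - a % n) % n + a ≡ (n - a % n) + a % n [MOD n] :=
          (Nat.mod_modEq _ _).add (Nat.mod_modEq _ _).symm
      _ = n := Nat.sub_add_cancel (Nat.mod_lt _ hpos).le
      _ ≡ 0 [MOD n] := by simp [Nat.ModEq]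
  have hwinv : ∀ a : ℕ, (α ^ ((n - a % n) % n))⁻¹ = α ^ a := by
    intro a
    refine inv_eq_of_mul_eq_one_right ?_
    rw [← pow_add]
    obtain ⟨t, ht⟩ := hdvd a
    rw [ht, pow_mul, hα.pow_eq_one, one_pow]
  have hw : w ∈ nonzeros n Z := by
    rw [mem_nonzeros]
    exact fun hmem => hneg z hz _ hmem (hdvd _) (hdvd _)
  have hSw : S w = 0 := by simpa [hw] using congrFun hS w
  have hpow : codePolyEval u (α ^ z.1) (α ^ z.2) ^ q = S w := by
    change FiniteField.frobeniusAlgHom F L _ = _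
    simp only [S, w]
    rw [codePolyEval, map_sum]
    simp_rw [hwinv]
    refine Finset.sum_congr rfl fun ij _ => ?_
    change (_ : L) ^ q = _
    rw [mul_assoc, mul_pow, mul_pow, map_pow, mul_comm q, mul_comm q, pow_mul, pow_mul,
      pow_right_comm (α ^ z.1), pow_right_comm (α ^ z.2)]
  exact eq_zero_of_pow_eq_zero (hpow.trans hSw)

/-- The transform of the all-ones array is supported at `(0, 0)`. -/
theorem one_mem_zeroCode (hα : IsPrimitiveRoot α n) {Z : Set (ℕ × ℕ)}
    (hZ : ∀ z ∈ Z, z.1 < n ∧ z.2 < n) (h0 : (0, 0) ∉ Z) :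
    (1 : Fin n × Fin n → K) ∈ zeroCode K n α Z := by
  intro z hz
  have h := sum_character_mul_inv hα 0 0 z.1 z.2
  rw [if_neg] at h
  · rw [← h]; simp [codePolyEval]
  · rintro ⟨h1, h2⟩
    have e1 : z.1 = 0 := h1.eq_of_lt_of_lt (hZ z hz).1 (by have := (hZ z hz).1; omega)
    have e2 : z.2 = 0 := h2.eq_of_lt_of_lt (hZ z hz).2 (by have := (hZ z hz).2; omega)
    exact h0 ((Prod.ext e1 e2 : z = (0, 0)) ▸ hz)

/-- The products of the all-ones array with the codewords are their transforms at `(0, 0)`. -/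
theorem one_notMem_hermitianDual {F : Type*} [Fintype F] [Fintype K] (hn : 0 < n)
    {C : Submodule K (Fin n × Fin n → K)} (h : (0, 0) ∉ definingSet α α C) :
    (1 : Fin n × Fin n → K) ∉ hermitianDual F C := by
  intro h1
  refine h ⟨hn, hn, fun c hc => ?_⟩
  have := congrArg (algebraMap K L) (h1 c hc)
  simpa [codePolyEval] using this

/-- The hyperbolic bound. For the lexicographically least `(x, y)` at which the transform of `c`
does not vanish, the `x y` characters with exponents in `[0, x) × [0, y)` are linearly independent
on the support of `c`: their products with the complementary characters give a triangular
matrix. -/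
theorem le_card_support_of_codePolyEval_eq_zero (hα : IsPrimitiveRoot α n) (hn0 : (n : L) ≠ 0)
    {d : ℕ} {c : Fin n × Fin n → K} (hc : c ≠ 0)
    (h : ∀ x y, 1 ≤ x → x ≤ n → 1 ≤ y → y ≤ n → x * y < d →
      codePolyEval c (α ^ x) (α ^ y) = 0) :
    d ≤ {ij | c ij ≠ 0}.ncard := by
  classical
  have hpos : 0 < n := Nat.pos_of_ne_zero (by rintro rfl; simp at hn0)
  have hper : ∀ y : ℕ, ∃ y', 1 ≤ y' ∧ y' ≤ n ∧ α ^ y = α ^ y' := by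
    intro y
    rcases Nat.eq_zero_or_pos (y % n) with h | h
    · exact ⟨n, hpos, le_rfl, hα.pow_eq_pow_of_modEq (by simp [Nat.ModEq, h])⟩
    · exact ⟨y % n, h, (Nat.mod_lt _ hpos).le, hα.pow_eq_pow_of_modEq (Nat.mod_modEq _ _).symm⟩
  have hex : ∃ x, 1 ≤ x ∧ x ≤ n ∧ ∃ y, codePolyEval c (α ^ x) (α ^ y) ≠ 0 := by
    by_contra! hall
    apply hc
    have : (fun ij => algebraMap K L (c ij)) = 0 :=
      eq_zero_of_codePolyEval_eq_zero hα hn0 fun w => by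
        obtain ⟨x, hx1, hxn, hx⟩ := hper w.1
        rw [codePolyEval_algebraMap, hx]
        exact hall x hx1 hxn w.2
    funext ij
    simpa using congrFun this ij
  obtain ⟨hx1, hxn, hxy⟩ := Nat.find_spec hex
  have hxmin : ∀ x', 1 ≤ x' → x' < Nat.find hex → ∀ y, codePolyEval c (α ^ x') (α ^ y) = 0 := by
    intro x' h1 h2 y
    by_contra h3
    exact Nat.find_min hex h2 ⟨h1, by omega, y, h3⟩
  generalize Nat.find hex = x at hx1 hxn hxy hxmin
  replace hxy : ∃ y, 1 ≤ y ∧ y ≤ n ∧ codePolyEval c (α ^ x) (α ^ y) ≠ 0 := by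
    obtain ⟨y, hy⟩ := hxy
    obtain ⟨y', h1, h2, h3⟩ := hper y
    exact ⟨y', h1, h2, h3 ▸ hy⟩
  obtain ⟨hy1, hyn, hy⟩ := Nat.find_spec hxy
  have hymin : ∀ y', 1 ≤ y' → y' < Nat.find hxy → codePolyEval c (α ^ x) (α ^ y') = 0 := by
    intro y' h1 h2
    by_contra h3
    exact Nat.find_min hxy h2 ⟨h1, by omega, h3⟩
  generalize Nat.find hxy = y at hy1 hyn hy hymin
  have hd : d ≤ x * y := by
    by_contra hlt
    exact hy (h x y hx1 hxn hy1 hyn (by omega))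
  let v : Fin x × Fin y → ({ij // c ij ≠ 0} → L) := fun u ij =>
    (α ^ (u.1 : ℕ)) ^ (ij.1.1 : ℕ) * (α ^ (u.2 : ℕ)) ^ (ij.1.2 : ℕ)
  have hv : LinearIndependent L v := by
    rw [Fintype.linearIndependent_iff]
    intro g hg
    by_contra! hne
    obtain ⟨u₀, hu₀⟩ := hne
    obtain ⟨u, hu, hmax⟩ := Finset.exists_max_image (Finset.univ.filter fun u => g u ≠ 0)
      (fun u => (toLex u : Fin x ×ₗ Fin y)) ⟨u₀, by simpa using hu₀⟩
    have hsum : ∑ ij : Fin n × Fin n, algebraMap K L (c ij) *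
        ((α ^ (x - u.1 : ℕ)) ^ (ij.1 : ℕ) * (α ^ (y - u.2 : ℕ)) ^ (ij.2 : ℕ)) *
        (∑ u', g u' * ((α ^ (u'.1 : ℕ)) ^ (ij.1 : ℕ) * (α ^ (u'.2 : ℕ)) ^ (ij.2 : ℕ))) = 0 := by
      refine Finset.sum_eq_zero fun ij _ => ?_
      by_cases hij : c ij = 0
      · simp [hij]
      · have := congrFun hg ⟨ij, hij⟩
        simp only [v, Finset.sum_apply, Pi.smul_apply, smul_eq_mul, Pi.zero_apply] at this
        rw [this, mul_zero]
    simp_rw [Finset.mul_sum] at hsum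
    rw [Finset.sum_comm] at hsum
    have hterm : ∀ u' : Fin x × Fin y, ∑ ij : Fin n × Fin n, algebraMap K L (c ij) *
        ((α ^ (x - u.1 : ℕ)) ^ (ij.1 : ℕ) * (α ^ (y - u.2 : ℕ)) ^ (ij.2 : ℕ)) *
        (g u' * ((α ^ (u'.1 : ℕ)) ^ (ij.1 : ℕ) * (α ^ (u'.2 : ℕ)) ^ (ij.2 : ℕ))) =
        g u' * codePolyEval c (α ^ (x - u.1 + u'.1 : ℕ)) (α ^ (y - u.2 + u'.2 : ℕ)) := by
      intro u'
      rw [codePolyEval, Finset.mul_sum]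
      refine Finset.sum_congr rfl fun ij _ => ?_
      rw [pow_add, pow_add, mul_pow, mul_pow]
      ring
    simp_rw [hterm] at hsum
    have hu1 := u.1.2
    have hu2 := u.2.2
    rw [Finset.sum_eq_single u] at hsum
    · rw [Nat.sub_add_cancel hu1.le, Nat.sub_add_cancel hu2.le] at hsum
      exact (mul_ne_zero (by simpa using hu) hy) hsum
    · intro u' _ hu'
      by_cases hg' : g u' = 0
      · rw [hg', zero_mul]
      have hle := hmax u' (by simpa using hg')
      rw [Prod.Lex.toLex_le_toLex] at hle
      rcases hle with hlt | ⟨heq, hle⟩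
      · have hlt' : (u'.1 : ℕ) < u.1 := hlt
        rw [hxmin _ (by omega) (by omega), mul_zero]
      · have hlt' : (u'.2 : ℕ) < u.2 := lt_of_le_of_ne hle fun hc' =>
          hu' (Prod.ext heq (Fin.ext hc'))
        rw [heq, Nat.sub_add_cancel hu1.le, hymin _ (by omega) (by omega), mul_zero]
    · simp
  have := hv.fintype_card_le_finrank
  rw [Module.finrank_pi, Fintype.card_prod, Fintype.card_fin, Fintype.card_fin] at this
  refine hd.trans (this.trans (le_of_eq ?_))
  rw [← Nat.card_coe_set_eq, ← Nat.card_eq_fintype_card]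
  rfl

end ZeroCode

/-! ### Stabilizer codes of isotropic groups of errors -/

section CommonEigenvector

/-- A commuting family of endomorphisms has a common eigenvector: on a minimal nonzero invariant
subspace each member is a scalar. -/
theorem exists_common_eigenvector {k V I : Type*} [Field k] [IsAlgClosed k] [AddCommGroup V]
    [Module k V] [FiniteDimensional k V] [Nontrivial V] (f : I → Module.End k V)
    (hf : ∀ i j, Commute (f i) (f j)) : ∃ ψ : V, ψ ≠ 0 ∧ ∀ i, ∃ c : k, f i ψ = c • ψ := by
  obtain ⟨W, ⟨hW0, hWinv⟩, hmin⟩ := IsArtinian.set_has_minimal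
    {W : Submodule k V | W ≠ ⊥ ∧ ∀ i, ∀ w ∈ W, f i w ∈ W} ⟨⊤, top_ne_bot, fun _ _ _ => trivial⟩
  obtain ⟨ψ, hψ, hψ0⟩ := W.ne_bot_iff.1 hW0
  refine ⟨ψ, hψ0, fun i => ?_⟩
  have : Nontrivial W := W.nontrivial_iff_ne_bot.2 hW0
  obtain ⟨μ, hμ⟩ := Module.End.exists_eigenvalue ((f i).restrict (hWinv i))
  obtain ⟨w, hw, hw0⟩ := hμ.exists_hasEigenvector
  rw [Module.End.mem_eigenspace_iff] at hw
  have hw' : f i w = μ • (w : V) := congrArg Subtype.val hw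
  let W' := W ⊓ Module.End.eigenspace (f i) μ
  have hW' : W' ∈ {W : Submodule k V | W ≠ ⊥ ∧ ∀ i, ∀ w ∈ W, f i w ∈ W} := by
    refine ⟨W'.ne_bot_iff.2 ⟨w, ⟨w.2, Module.End.mem_eigenspace_iff.2 hw'⟩, by simpa using hw0⟩,
      fun j v hv => ⟨hWinv j v hv.1, Module.End.mem_eigenspace_iff.2 ?_⟩⟩
    have h1 := Module.End.mem_eigenspace_iff.1 hv.2
    have h2 : f i (f j v) = f j (f i v) := LinearMap.congr_fun (hf i j) v
    rw [h2, h1, map_smul]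
  have heq : W' = W := (lt_or_eq_of_le (inf_le_left : W' ≤ W)).resolve_left (hmin W' hW')
  exact ⟨μ, Module.End.mem_eigenspace_iff.1 ((heq ▸ hψ : ψ ∈ W').2)⟩

end CommonEigenvector

section ErrorGroup

variable (p : ℕ) [Fact p.Prime] {F : Type*} [Field F] [Algebra (ZMod p) F]
variable {ι : Type*} [Fintype ι]

/-- The additive character `t ↦ exp(2πi tr(t) / p)` of `F`. -/
noncomputable def errorChar (F : Type*) [Field F] [Algebra (ZMod p) F] : AddChar F ℂ :=
  (ZMod.stdAddChar (N := p)).compAddMonoidHom (Algebra.trace (ZMod p) F).toAddMonoidHom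

theorem errorOp_apply (a b : ι → F) (ψ : QuditSpace F ι) (x : ι → F) :
    errorOp p a b ψ x = errorChar p F (b ⬝ᵥ (x - a)) * ψ (x - a) := rfl

theorem errorOp_zero : errorOp p (0 : ι → F) 0 = LinearMap.id := by
  ext ψ x
  simp [errorOp_apply]

theorem errorOp_errorOp (a b a' b' : ι → F) :
    errorOp p a b * errorOp p a' b' =
      errorChar p F (b ⬝ᵥ a') • errorOp p (a + a') (b + b') := by
  refine LinearMap.ext fun ψ => PiLp.ext fun x => ?_
  rw [Module.End.mul_apply, errorOp_apply, errorOp_apply, LinearMap.smul_apply, PiLp.smul_apply,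
    errorOp_apply, smul_eq_mul, ← mul_assoc, ← mul_assoc, ← AddChar.map_add_eq_mul,
    ← AddChar.map_add_eq_mul, sub_sub]
  congr 2
  simp only [add_dotProduct, dotProduct_sub, dotProduct_add]
  ring

variable [Fintype F]

theorem exists_errorChar_mul_ne_one {t : F} (ht : t ≠ 0) : ∃ s, errorChar p F (s * t) ≠ 1 := by
  obtain ⟨r, hr⟩ := Algebra.trace_surjective (ZMod p) F 1
  refine ⟨r * t⁻¹, fun h => ?_⟩
  rw [inv_mul_cancel_right₀ ht] at h
  change ZMod.stdAddChar (Algebra.trace (ZMod p) F r) = 1 at h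
  rw [hr, ← AddChar.map_zero_eq_one (ZMod.stdAddChar (N := p))] at h
  exact one_ne_zero (ZMod.injective_stdAddChar h)

theorem inner_errorOp_errorOp [DecidableEq ι] (a b : ι → F) (u v : QuditSpace F ι) :
    inner ℂ (errorOp p a b u) (errorOp p a b v) = inner ℂ u v := by
  rw [PiLp.inner_apply, PiLp.inner_apply]
  conv_rhs => rw [← Equiv.sum_comp (Equiv.subRight a)]
  refine Finset.sum_congr rfl fun x _ => ?_
  have h : ‖errorChar p F (b ⬝ᵥ (x - a))‖ = 1 := AddChar.norm_apply _ _
  simp only [errorOp_apply, RCLike.inner_apply, Equiv.subRight_apply, map_mul]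
  rw [mul_mul_mul_comm, Complex.mul_conj', h]
  simp

theorem norm_errorOp [DecidableEq ι] (a b : ι → F) (u : QuditSpace F ι) :
    ‖errorOp p a b u‖ = ‖u‖ := by
  rw [@norm_eq_sqrt_re_inner ℂ, @norm_eq_sqrt_re_inner ℂ, inner_errorOp_errorOp]

theorem norm_eq_one_of_smul_errorOp_eq [DecidableEq ι] {a b : ι → F} {u : QuditSpace F ι} {c : ℂ}
    (hu : u ≠ 0) (h : errorOp p a b u = c • u) : ‖c‖ = 1 := by
  have h1 := congrArg norm h
  rw [norm_errorOp, norm_smul] at h1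
  exact (mul_right_cancel₀ (norm_ne_zero_iff.2 hu) (h1.symm.trans (one_mul _).symm))

/-- Errors other than the identity have trace zero: `X(a)` with `a ≠ 0` moves every ket, and the
trace of `Z(b)` is a sum of values of a nontrivial character. -/
theorem trace_errorOp [DecidableEq ι] (a b : ι → F) :
    LinearMap.trace ℂ (QuditSpace F ι) (errorOp p a b) =
      open Classical in if a = 0 ∧ b = 0 then (Fintype.card F : ℂ) ^ Fintype.card ι else 0 := by
  classical
  rw [LinearMap.trace_eq_sum_inner _ (EuclideanSpace.basisFun (ι → F) ℂ)]
  simp only [EuclideanSpace.basisFun_apply, EuclideanSpace.inner_single_left, map_one, one_mul,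
    errorOp_apply]
  by_cases ha : a = 0
  · subst ha
    simp only [sub_zero, PiLp.single_apply, if_true, mul_one, true_and]
    let χ : AddChar (ι → F) ℂ := (errorChar p F).compAddMonoidHom
      { toFun := fun x => b ⬝ᵥ x, map_zero' := dotProduct_zero b, map_add' := dotProduct_add b }
    change ∑ x, χ x = _
    rw [AddChar.sum_eq_ite]
    by_cases hb : b = 0
    · subst hb
      have : χ = 0 := by ext x; simp [χ]
      simp [this]
    · obtain ⟨i, hi⟩ := Function.ne_iff.1 hb
      obtain ⟨s, hs⟩ := exists_errorChar_mul_ne_one p hi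
      rw [if_neg, if_neg hb]
      intro h
      have := DFunLike.congr_fun h (Pi.single i s)
      apply hs
      simpa [χ, mul_comm s] using this
  · rw [if_neg (fun h => ha h.1)]
    refine Finset.sum_eq_zero fun x _ => ?_
    rw [PiLp.single_apply, if_neg, mul_zero]
    simpa using ha

/-- An error operator determines its label `(a, b)`, even up to a scalar. -/
theorem eq_of_smul_errorOp_eq [DecidableEq ι] {a b a' b' : ι → F} {c c' : ℂ} (hc : c ≠ 0)
    (h : c • errorOp p a b = c' • errorOp p a' b') : a = a' ∧ b = b' := by
  have h1 := congrArg (fun T => LinearMap.trace ℂ (QuditSpace F ι) (T * errorOp p (-a) (-b))) h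
  simp only [smul_mul_assoc, errorOp_errorOp, map_smul, trace_errorOp, add_neg_cancel, and_self,
    if_true] at h1
  by_contra hne
  rw [if_neg (by rwa [add_neg_eq_zero, add_neg_eq_zero, eq_comm, @eq_comm _ b'])] at h1
  have hχ : errorChar p F (b ⬝ᵥ -a) ≠ 0 := fun h0 => by
    have := AddChar.norm_apply (errorChar p F) (b ⬝ᵥ -a)
    rw [h0, norm_zero] at this
    exact zero_ne_one this
  have hF : (Fintype.card F : ℂ) ^ Fintype.card ι ≠ 0 := by simp
  exact mul_ne_zero hc (mul_ne_zero hχ hF) (by simpa only [smul_eq_mul, mul_zero] using h1)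

/-- The stabilizer code of an isotropic group `D` of labels `(a, b)`: the operators `X(a) Z(b)`
commute, and rescaling each of them to fix a common eigenvector gives a representation of `D`,
whose space of invariants is the code. Its dimension is the average of the character. -/
theorem exists_stabilizerCode [DecidableEq ι] (D : AddSubgroup ((ι → F) × (ι → F)))
    (hD : ∀ v ∈ D, ∀ w ∈ D, errorChar p F (v.2 ⬝ᵥ w.1) = errorChar p F (w.2 ⬝ᵥ v.1)) :
    ∃ (S : Subgroup (QuditSpace F ι ≃ₗ[ℂ] QuditSpace F ι)) (Q : Submodule ℂ (QuditSpace F ι)),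
      IsStabilizerCode p S Q ∧
      (∀ a b : ι → F, (∃ E ∈ S, ∃ c : ℂ,
        (E : QuditSpace F ι →ₗ[ℂ] QuditSpace F ι) = c • errorOp p a b) ↔ (a, b) ∈ D) ∧
      Module.finrank ℂ Q * Nat.card D = Fintype.card F ^ Fintype.card ι := by
  classical
  have hcomm : ∀ v w : D, Commute (errorOp p v.1.1 v.1.2) (errorOp p w.1.1 w.1.2) := by
    intro v w
    rw [Commute, SemiconjBy, errorOp_errorOp, errorOp_errorOp, hD v v.2 w w.2, add_comm v.1.1,
      add_comm v.1.2]
  obtain ⟨ψ, hψ, hc⟩ := exists_common_eigenvector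
    (fun v : D => errorOp p v.1.1 v.1.2) hcomm
  choose c hc using hc
  have hcn : ∀ v, ‖c v‖ = 1 := fun v => norm_eq_one_of_smul_errorOp_eq p hψ (hc v)
  have hc0 : ∀ v, c v ≠ 0 := fun v h => by simpa [h] using hcn v
  have hmul : ∀ v w : D, c v * c w = errorChar p F (v.1.2 ⬝ᵥ w.1.1) * c (v + w) := by
    intro v w
    have h := LinearMap.congr_fun (errorOp_errorOp p v.1.1 v.1.2 w.1.1 w.1.2) ψ
    rw [Module.End.mul_apply, hc w, map_smul, hc v, LinearMap.smul_apply] at h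
    erw [hc (v + w)] at h
    rw [smul_smul, smul_smul] at h
    rw [mul_comm]
    exact smul_left_injective ℂ hψ h
  let ρ : Representation ℂ (Multiplicative D) (QuditSpace F ι) :=
    { toFun := fun v => (c v.toAdd)⁻¹ • errorOp p v.toAdd.1.1 v.toAdd.1.2
      map_one' := by
        have h1 := hc 0
        change errorOp p 0 0 ψ = _ at h1
        rw [errorOp_zero, LinearMap.id_apply] at h1
        have h2 : c 0 = 1 :=
          (smul_left_injective ℂ hψ (h1.symm.trans (one_smul ℂ ψ).symm) : c 0 = 1)
        change (c 0)⁻¹ • errorOp p 0 0 = 1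
        rw [h2, errorOp_zero, inv_one, one_smul]
        rfl
      map_mul' := fun v w => by
        rw [smul_mul_smul_comm, errorOp_errorOp, smul_smul, ← mul_inv, hmul, mul_inv_rev, mul_assoc,
          inv_mul_cancel₀, mul_one]
        · rfl
        · intro h0
          have := hmul v.toAdd w.toAdd
          rw [h0, zero_mul] at this
          exact mul_ne_zero (hc0 _) (hc0 _) this }
  have hρ : ∀ v, ρ v = (c v.toAdd)⁻¹ • errorOp p v.toAdd.1.1 v.toAdd.1.2 := fun v => rfl
  let σ : Multiplicative D →* (QuditSpace F ι ≃ₗ[ℂ] QuditSpace F ι) :=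
    (LinearMap.GeneralLinearGroup.generalLinearEquiv ℂ (QuditSpace F ι)).toMonoidHom.comp
      ρ.toHomUnits
  have hσ : ∀ v, (σ v : QuditSpace F ι →ₗ[ℂ] QuditSpace F ι) = ρ v := fun v => rfl
  refine ⟨σ.range, ρ.invariants, ⟨?_, ?_, ?_⟩, ?_, ?_⟩
  · rintro _ ⟨v, rfl⟩
    exact ⟨(c v.toAdd)⁻¹, v.toAdd.1.1, v.toAdd.1.2, by rw [norm_inv, hcn, inv_one], hσ v⟩
  · intro v
    rw [Representation.mem_invariants]
    exact ⟨by rintro h _ ⟨w, rfl⟩; exact h w, fun h w => h (σ w) ⟨w, rfl⟩⟩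
  · refine (Submodule.ne_bot_iff _).2 ⟨ψ, ?_, hψ⟩
    rw [Representation.mem_invariants]
    intro v
    rw [hρ, LinearMap.smul_apply, hc, smul_smul, inv_mul_cancel₀ (hc0 _), one_smul]
  · intro a b
    constructor
    · rintro ⟨_, ⟨v, rfl⟩, t, ht⟩
      rw [hσ, hρ] at ht
      obtain ⟨rfl, rfl⟩ := eq_of_smul_errorOp_eq p (inv_ne_zero (hc0 _)) ht
      exact v.toAdd.2
    · intro hab
      exact ⟨σ (Multiplicative.ofAdd ⟨(a, b), hab⟩), ⟨_, rfl⟩, _, rfl⟩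
  · have hcard : (Nat.card (Multiplicative D) : ℂ) ≠ 0 := by
      exact_mod_cast Nat.card_pos.ne'
    have : Fintype (Multiplicative D) := Fintype.ofFinite _
    have : Invertible (Nat.card (Multiplicative D) : ℂ) := invertibleOfNonzero hcard
    have h := Representation.card_inv_mul_sum_char_eq_finrank ρ
    rw [Finset.sum_eq_single 1] at h
    · rw [Representation.char_one, finrank_euclideanSpace, Fintype.card_fun] at h
      have h2 : (Module.finrank ℂ ρ.invariants : ℂ) * Nat.card D =
          ((Fintype.card F ^ Fintype.card ι : ℕ) : ℂ) := by
        rw [← h]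
        change _ * (Nat.card (Multiplicative D) : ℂ) = _
        rw [mul_comm, mul_inv_cancel_left₀ hcard]
      exact_mod_cast h2
    · intro v _ hv
      rw [Representation.character, hρ, map_smul, trace_errorOp, if_neg, smul_zero]
      rintro ⟨h1, h2⟩
      exact hv (Subtype.ext (Prod.ext h1 h2))
    · simp

/-- An error that does not commute with some stabilizer element maps the code into its orthogonal
complement. -/
theorem inner_errorOp_eq_zero [DecidableEq ι] {a b a' b' : ι → F} {u v : QuditSpace F ι} {c : ℂ}
    (hne : errorChar p F (b ⬝ᵥ a') ≠ errorChar p F (b' ⬝ᵥ a))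
    (hu : c • errorOp p a' b' u = u) (hv : c • errorOp p a' b' v = v) :
    inner ℂ u (errorOp p a b v) = 0 := by
  by_cases hu0 : u = 0
  · simp [hu0]
  have hc0 : c ≠ 0 := by rintro rfl; exact hu0 (by rw [← hu, zero_smul])
  have hu' : errorOp p a' b' u = c⁻¹ • u := by
    rw [← hu, smul_smul, inv_mul_cancel₀ hc0, one_smul, hu]
  have hv' : errorOp p a' b' v = c⁻¹ • v := by
    rw [← hv, smul_smul, inv_mul_cancel₀ hc0, one_smul, hv]
  have hc1 : ‖c⁻¹‖ = 1 := norm_eq_one_of_smul_errorOp_eq p hu0 hu'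
  have h1 := LinearMap.congr_fun (errorOp_errorOp p a b a' b') v
  have h2 := LinearMap.congr_fun (errorOp_errorOp p a' b' a b) v
  rw [Module.End.mul_apply, LinearMap.smul_apply, hv', map_smul] at h1
  rw [Module.End.mul_apply, LinearMap.smul_apply, add_comm a', add_comm b'] at h2
  have h3 := inner_errorOp_errorOp p a' b' u (errorOp p a b v)
  have h4 : errorChar p F (b ⬝ᵥ a') • errorOp p a' b' (errorOp p a b v) =
      (errorChar p F (b' ⬝ᵥ a) * c⁻¹) • errorOp p a b v := by
    rw [h2, smul_smul, mul_comm, ← smul_smul, ← h1, smul_smul]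
  have h5 := congrArg (inner ℂ (errorOp p a' b' u)) h4
  rw [inner_smul_right, inner_smul_right, h3, hu', inner_smul_left, mul_assoc, ← mul_assoc c⁻¹,
    Complex.mul_conj', hc1, Complex.ofReal_one, one_pow, one_mul] at h5
  by_contra h6
  exact hne (mul_right_cancel₀ h6 h5)

end ErrorGroup

/-! ### The Hermitian construction -/

section Hermitian

variable {F K : Type*} [Fintype F] [Field K]

theorem pow_card_pow_card [Fintype K] (hK : Fintype.card K = Fintype.card F ^ 2) (x : K) :
    (x ^ Fintype.card F) ^ Fintype.card F = x := by
  rw [← pow_mul, ← sq, ← hK, FiniteField.pow_card]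

theorem smul_mem_hermitianDual {ι : Type*} [Fintype ι] {C : Submodule K (ι → K)} {u : ι → K}
    (hu : u ∈ hermitianDual F C) (μ : K) :
    μ • u ∈ hermitianDual F C := by
  intro c hc
  simp_rw [Pi.smul_apply, smul_eq_mul, mul_pow, mul_assoc, ← Finset.mul_sum]
  rw [hu c hc, mul_zero]

section Dual

variable [Fintype K] {ι : Type*} [Fintype ι] {C : Submodule K (ι → K)}

/-- The Hermitian dual is the conjugate of the annihilator of the code. -/
theorem card_hermitianDual_mul (hK : Fintype.card K = Fintype.card F ^ 2) :
    Nat.card (hermitianDual F C) * Fintype.card F ^ (2 * Module.finrank K C) =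
      Fintype.card F ^ (2 * Fintype.card ι) := by
  classical
  have e : hermitianDual F C ≃ C.dualAnnihilator :=
    { toFun := fun u => ⟨dotProductEquiv K ι (fun i => u.1 i ^ Fintype.card F), by
        rw [Submodule.mem_dualAnnihilator]
        intro c hc
        exact u.2 c hc⟩
      invFun := fun f => ⟨fun i => (dotProductEquiv K ι).symm f.1 i ^ Fintype.card F, by
        intro c hc
        simp_rw [pow_card_pow_card hK]
        have h := (Submodule.mem_dualAnnihilator _).1 f.2 c hc
        rw [← (dotProductEquiv K ι).apply_symm_apply f.1] at h
        exact h⟩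
      left_inv := fun u => by
        ext i
        simp [pow_card_pow_card hK]
      right_inv := fun f => by
        apply Subtype.ext
        simp_rw [pow_card_pow_card hK]
        exact (dotProductEquiv K ι).apply_symm_apply f.1 }
  have h1 := Subspace.finrank_add_finrank_dualAnnihilator_eq C
  rw [Module.finrank_fintype_fun_eq_card] at h1
  rw [Nat.card_congr e, Module.natCard_eq_pow_finrank (K := K), Nat.card_eq_fintype_card, hK,
    ← pow_mul, ← pow_add, ← h1]
  congr 1
  ring

/-- The Hermitian dual of the Hermitian dual is contained in the code. -/
theorem mem_of_forall_hermitianDual (hK : Fintype.card K = Fintype.card F ^ 2) {w : ι → K}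
    (h : ∀ v ∈ hermitianDual F C, ∑ i, v i ^ Fintype.card F * w i = 0) : w ∈ C := by
  classical
  by_contra hw
  obtain ⟨f, hf, hfC⟩ := Submodule.exists_dual_map_eq_bot_of_notMem hw inferInstance
  obtain ⟨u, rfl⟩ := (dotProductEquiv K ι).surjective f
  apply hf
  have := h (fun i => u i ^ Fintype.card F) (by
    intro c hc
    simp_rw [pow_card_pow_card hK]
    have : dotProductEquiv K ι u c ∈ C.map (dotProductEquiv K ι u) := Submodule.mem_map_of_mem hc
    rw [hfC] at this
    exact this)
  simp_rw [pow_card_pow_card hK] at this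
  exact this

/-- A code that properly contains its Hermitian dual has more than half the full dimension. -/
theorem lt_two_mul_finrank [Nontrivial F] (hK : Fintype.card K = Fintype.card F ^ 2)
    (hC : hermitianDual F C ⊆ (C : Set (ι → K))) {u : ι → K} (hu : u ∈ C)
    (hu' : u ∉ hermitianDual F C) : Fintype.card ι < 2 * Module.finrank K C := by
  have hq : 1 < Fintype.card F := Fintype.one_lt_card
  have h1 := card_hermitianDual_mul (C := C) hK
  have h2 : Nat.card (hermitianDual F C) < Fintype.card F ^ (2 * Module.finrank K C) := by
    have h3 : Nat.card C = Fintype.card F ^ (2 * Module.finrank K C) := by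
      rw [Module.natCard_eq_pow_finrank (K := K), Nat.card_eq_fintype_card, hK, ← pow_mul]
    rw [← h3]
    exact Set.ncard_lt_ncard ⟨hC, fun h => hu' (h hu)⟩
  have h4 := Nat.mul_lt_mul_of_pos_right h2
    (show 0 < Fintype.card F ^ (2 * Module.finrank K C) by positivity)
  rw [h1, ← pow_add] at h4
  have := (Nat.pow_lt_pow_iff_right hq).1 h4
  omega

end Dual

variable [Field F] [Algebra F K]

section NormalBasis

variable {θ : K}

theorem ne_and_sq_ne_of_linearIndependent
    (hθ : LinearIndependent F ![θ, θ ^ Fintype.card F]) :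
    θ ≠ θ ^ Fintype.card F ∧ θ ^ 2 ≠ (θ ^ Fintype.card F) ^ 2 := by
  rw [LinearIndependent.pair_iff] at hθ
  have h1 : θ ≠ θ ^ Fintype.card F := fun h => one_ne_zero (hθ 1 (-1) (by rw [← h]; simp)).1
  refine ⟨h1, fun h => ?_⟩
  rcases sq_eq_sq_iff_eq_or_eq_neg.1 h with h | h
  · exact h1 h
  · refine one_ne_zero (hθ 1 1 ?_).1
    rw [one_smul, one_smul]
    nth_rewrite 1 [h]
    exact neg_add_cancel _

/-- A generator of the multiplicative group of the quadratic extension generates a normal basis: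
otherwise its order `q² - 1` would divide `(q - 1)²`. -/
theorem exists_linearIndependent_pow_card [Fintype K]
    (hK : Fintype.card K = Fintype.card F ^ 2) :
    ∃ θ : K, LinearIndependent F ![θ, θ ^ Fintype.card F] := by
  classical
  obtain ⟨g, hg⟩ := IsCyclic.exists_generator (α := Kˣ)
  have hord := orderOf_eq_card_of_forall_mem_zpowers hg
  rw [Nat.card_eq_fintype_card, Fintype.card_units, hK] at hord
  have hq : 1 < Fintype.card F := Fintype.one_lt_card
  obtain ⟨r, hr⟩ : ∃ r, Fintype.card F = r + 1 := ⟨Fintype.card F - 1, by omega⟩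
  refine ⟨g, ?_⟩
  rw [LinearIndependent.pair_iff]
  intro s t hst
  have hg0 : (g : K) ≠ 0 := g.ne_zero
  rw [Algebra.smul_def, Algebra.smul_def] at hst
  have ht : t = 0 := by
    by_contra ht
    have hpow : (g : K) ^ r = algebraMap F K (-s / t) := by
      have h0 : algebraMap F K t ≠ 0 := by simpa using ht
      rw [map_div₀, map_neg, eq_div_iff h0]
      apply mul_right_cancel₀ hg0
      rw [hr, pow_succ] at hst
      linear_combination hst
    have hs : -s / t ≠ 0 := by
      intro h
      rw [h, map_zero] at hpow
      exact pow_ne_zero _ hg0 hpow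
    have h1 : (g : K) ^ (r * r) = 1 := by
      rw [pow_mul, hpow, ← map_pow]
      have := FiniteField.pow_card_sub_one_eq_one _ hs
      rw [hr, Nat.add_sub_cancel] at this
      rw [this, map_one]
    have h2 : orderOf g ∣ r * r := orderOf_dvd_of_pow_eq_one (Units.ext (by simpa using h1))
    have h3 := Nat.le_of_dvd (by positivity [show 0 < r by omega]) h2
    rw [hord, hr] at h3
    have : (r + 1) ^ 2 = r * r + 2 * r + 1 := by ring
    omega
  subst ht
  rw [map_zero, zero_mul, add_zero] at hst
  exact ⟨by simpa [hg0] using hst, rfl⟩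

variable {ι : Type*}

/-- The coordinates `(a, b) ↦ θ a + θ^q b`. -/
def normalCoord (F : Type*) [Field F] [Fintype F] [Algebra F K] (ι : Type*) (θ : K) :
    ((ι → F) × (ι → F)) →+ (ι → K) where
  toFun v := fun i => v.1 i • θ + v.2 i • θ ^ Fintype.card F
  map_zero' := by ext; simp
  map_add' v w := by ext; simp [add_smul]; ring

theorem normalCoord_apply (v : (ι → F) × (ι → F)) (i : ι) :
    normalCoord F ι θ v i = v.1 i • θ + v.2 i • θ ^ Fintype.card F := rfl

theorem normalCoord_apply_eq_zero (hθ : LinearIndependent F ![θ, θ ^ Fintype.card F])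
    {v : (ι → F) × (ι → F)} {i : ι} : normalCoord F ι θ v i = 0 ↔ v.1 i = 0 ∧ v.2 i = 0 :=
  ⟨LinearIndependent.pair_iff.1 hθ _ _, fun h => by simp [normalCoord_apply, h.1, h.2]⟩

theorem normalCoord_bijective [Fintype K] [Fintype ι] (hK : Fintype.card K = Fintype.card F ^ 2)
    (hθ : LinearIndependent F ![θ, θ ^ Fintype.card F]) :
    Function.Bijective (normalCoord F ι θ) := by
  classical
  rw [Fintype.bijective_iff_injective_and_card]
  constructor
  · rw [injective_iff_map_eq_zero]
    intro v hv
    have h := fun i => (normalCoord_apply_eq_zero hθ).1 (congrFun hv i)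
    exact Prod.ext (funext fun i => (h i).1) (funext fun i => (h i).2)
  · rw [Fintype.card_prod, Fintype.card_fun, Fintype.card_fun, hK, ← pow_mul, ← pow_add, two_mul]

/-- The symplectic form of the coordinates is, up to the factor `θ^{2q} - θ²`, the Hermitian form
minus its conjugate. -/
theorem hermitian_sub_conj [Fintype K] [Fintype ι] (hK : Fintype.card K = Fintype.card F ^ 2)
    (v w : (ι → F) × (ι → F)) :
    ∑ i, normalCoord F ι θ v i ^ Fintype.card F * normalCoord F ι θ w i -
      (∑ i, normalCoord F ι θ v i ^ Fintype.card F * normalCoord F ι θ w i) ^ Fintype.card F =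
    ((θ ^ Fintype.card F) ^ 2 - θ ^ 2) * algebraMap F K (v.1 ⬝ᵥ w.2 - v.2 ⬝ᵥ w.1) := by
  have hadd : ∀ (a b : F) (x y : K), (a • x + b • y) ^ Fintype.card F =
      a • x ^ Fintype.card F + b • y ^ Fintype.card F := fun a b x y => by
    change FiniteField.frobeniusAlgHom F K _ = _
    rw [map_add, map_smul, map_smul]
    rfl
  have hsum : ∀ f : ι → K, (∑ i, f i) ^ Fintype.card F = ∑ i, f i ^ Fintype.card F := fun f => by
    change FiniteField.frobeniusAlgHom F K _ = _
    rw [map_sum]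
    rfl
  rw [hsum, ← Finset.sum_sub_distrib, dotProduct, dotProduct, ← Finset.sum_sub_distrib, map_sum,
    Finset.mul_sum]
  refine Finset.sum_congr rfl fun i _ => ?_
  rw [mul_pow, pow_card_pow_card hK, normalCoord_apply, normalCoord_apply, hadd, hadd,
    pow_card_pow_card hK]
  simp only [Algebra.smul_def, map_sub, map_mul]
  ring

end NormalBasis

variable {ι : Type*} [Fintype ι] {C : Submodule K (ι → K)}

/-- The Hermitian dual as an additive group. -/
def hermitianDualAddSubgroup (F : Type*) [Field F] [Fintype F] [Algebra F K]
    (C : Submodule K (ι → K)) : AddSubgroup (ι → K) where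
  carrier := hermitianDual F C
  zero_mem' := by intro c _; simp
  add_mem' {u v} hu hv := by
    intro c hc
    have hadd : ∀ x y : K, (x + y) ^ Fintype.card F = x ^ Fintype.card F + y ^ Fintype.card F :=
      fun x y => map_add (FiniteField.frobeniusAlgHom F K) x y
    simp_rw [Pi.add_apply, hadd, add_mul, Finset.sum_add_distrib]
    rw [hu c hc, hv c hc, add_zero]
  neg_mem' {u} hu := by simpa using smul_mem_hermitianDual hu (-1)

variable [Fintype K]

variable (p : ℕ) [Fact p.Prime] [Algebra (ZMod p) F]

/-- An error commuting with all errors labelled by the Hermitian dual is labelled by a codeword: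
its Hermitian products with the Hermitian dual, a `K`-space, all lie in `F`. -/
theorem normalCoord_mem_of_commute (hK : Fintype.card K = Fintype.card F ^ 2) {θ : K}
    (hθ : LinearIndependent F ![θ, θ ^ Fintype.card F]) {w : (ι → F) × (ι → F)}
    (h : ∀ v, normalCoord F ι θ v ∈ hermitianDual F C →
      errorChar p F (w.2 ⬝ᵥ v.1) = errorChar p F (v.2 ⬝ᵥ w.1)) : normalCoord F ι θ w ∈ C := by
  have hsymp : ∀ v, normalCoord F ι θ v ∈ hermitianDual F C → v.1 ⬝ᵥ w.2 - v.2 ⬝ᵥ w.1 = 0 := by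
    intro v hv
    by_contra hne
    obtain ⟨s, hs⟩ := exists_errorChar_mul_ne_one p hne
    have hsv : normalCoord F ι θ (s • v) = algebraMap F K s • normalCoord F ι θ v := by
      ext i
      simp [normalCoord_apply, Algebra.smul_def, mul_add, mul_assoc]
    have h1 := h (s • v) (hsv ▸ smul_mem_hermitianDual hv _)
    apply hs
    rw [mul_sub, AddChar.map_sub_eq_div, div_eq_one_iff_eq]
    · simpa [dotProduct_comm v.1] using h1
    · intro h0
      have := AddChar.norm_apply (errorChar p F) (s * (v.2 ⬝ᵥ w.1))
      rw [h0, norm_zero] at this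
      exact zero_ne_one this
  have hfix : ∀ x ∈ hermitianDual F C,
      (∑ i, x i ^ Fintype.card F * normalCoord F ι θ w i) ^ Fintype.card F =
        ∑ i, x i ^ Fintype.card F * normalCoord F ι θ w i := by
    intro x hx
    obtain ⟨v, rfl⟩ := (normalCoord_bijective hK hθ).2 x
    have := hermitian_sub_conj (θ := θ) hK v w
    rw [hsymp v hx, map_zero, mul_zero, sub_eq_zero] at this
    exact this.symm
  refine mem_of_forall_hermitianDual hK fun x hx => ?_
  have h1 := hfix x hx
  have h2 := hfix _ (smul_mem_hermitianDual hx θ)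
  simp_rw [Pi.smul_apply, smul_eq_mul, mul_pow, mul_assoc, ← Finset.mul_sum] at h2
  rw [mul_pow, pow_card_pow_card hK, h1, ← sub_eq_zero, ← sub_mul] at h2
  exact (mul_eq_zero.1 h2).resolve_left
    (sub_ne_zero.2 (ne_and_sq_ne_of_linearIndependent hθ).1)

/-- The Hermitian construction: the labels of the Hermitian dual form an isotropic group, an
undetectable error is labelled by a codeword of `C` of the same weight, and weights below `d` leave
only the identity. -/
theorem exists_isHermitianConstruction [DecidableEq ι] (hK : Fintype.card K = Fintype.card F ^ 2)
    (hC : hermitianDual F C ⊆ (C : Set (ι → K))) (hk : Fintype.card ι ≤ 2 * Module.finrank K C)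
    {d : ℕ} (hd : ∀ c ∈ C, c ≠ 0 → d ≤ {i | c i ≠ 0}.ncard) :
    ∃ Q : Submodule ℂ (QuditSpace F ι), IsHermitianConstruction p C Q ∧
      Module.finrank ℂ Q = Fintype.card F ^ (2 * Module.finrank K C - Fintype.card ι) ∧
      HasDistanceAtLeast p d Q := by
  classical
  obtain ⟨θ, hθ⟩ := exists_linearIndependent_pow_card hK
  let D := (hermitianDualAddSubgroup F C).comap (normalCoord F ι θ)
  have hD : ∀ v ∈ D, ∀ w ∈ D, errorChar p F (v.2 ⬝ᵥ w.1) = errorChar p F (w.2 ⬝ᵥ v.1) := by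
    intro v hv w hw
    have h1 := hermitian_sub_conj (θ := θ) hK v w
    rw [hv _ (hC hw), zero_pow Fintype.card_ne_zero, sub_zero, eq_comm, mul_eq_zero] at h1
    have h2 := h1.resolve_left
      (sub_ne_zero.2 (ne_and_sq_ne_of_linearIndependent hθ).2.symm)
    rw [map_eq_zero, sub_eq_zero] at h2
    rw [← h2, dotProduct_comm]
  obtain ⟨S, Q, hS, hSD, hcard⟩ := exists_stabilizerCode p D hD
  refine ⟨Q, ⟨θ, hθ, S, hS, hSD⟩, ?_, ?_⟩
  · have hDcard : Nat.card D = Nat.card (hermitianDual F C) :=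
      Nat.card_congr ((Equiv.ofBijective _ (normalCoord_bijective hK hθ)).subtypeEquiv
        fun _ => Iff.rfl)
    have h1 := card_hermitianDual_mul (C := C) hK
    rw [← hDcard] at h1
    have hpos : 0 < Nat.card D * Fintype.card F ^ Fintype.card ι :=
      Nat.mul_pos Nat.card_pos (by positivity)
    rw [← Nat.sub_add_cancel hk, pow_add] at h1
    apply Nat.eq_of_mul_eq_mul_right hpos
    rw [← mul_assoc, hcard, mul_left_comm, h1, two_mul, pow_add]
  · intro a b hab
    -- an error commuting with the stabilizer is the identity; any other maps `Q` into `Qᗮ`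
    by_cases hcomm : ∀ v, normalCoord F ι θ v ∈ hermitianDual F C →
        errorChar p F (b ⬝ᵥ v.1) = errorChar p F (v.2 ⬝ᵥ a)
    · have hmem := normalCoord_mem_of_commute p hK hθ (w := (a, b)) hcomm
      have hzero : normalCoord F ι θ (a, b) = 0 := by
        by_contra hne
        have h1 := hd _ hmem hne
        have h2 : {i | normalCoord F ι θ (a, b) i ≠ 0} = {i | a i ≠ 0 ∨ b i ≠ 0} := by
          ext i
          rw [Set.mem_ofPred_eq, Set.mem_ofPred_eq, Ne, normalCoord_apply_eq_zero hθ]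
          tauto
        rw [h2] at h1
        exact absurd h1 (not_le.2 hab)
      have h0 := (normalCoord_bijective hK hθ).1 (hzero.trans (map_zero _).symm)
      obtain ⟨rfl, rfl⟩ := Prod.ext_iff.1 h0
      refine ⟨1, fun u _ v _ => ?_⟩
      change inner ℂ u (errorOp p 0 0 v) = _
      rw [errorOp_zero, LinearMap.id_apply, one_mul]
    · push Not at hcomm
      obtain ⟨v, hv, hne⟩ := hcomm
      obtain ⟨E, hE, c, hEc⟩ := (hSD v.1 v.2).2 hv
      have hEQ : ∀ u ∈ Q, c • errorOp p v.1 v.2 u = u := fun u hu => by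
        rw [← LinearMap.smul_apply, ← hEc]
        exact (hS.mem_iff u).1 hu E hE
      exact ⟨0, fun u hu w hw => by
        rw [zero_mul, inner_errorOp_eq_zero p hne (hEQ u hu) (hEQ w hw)]⟩

end Hermitian

/-! ### Zeros of hyperbolic codes -/

section HyperbolicZeros

/-- The union of the `Q`-ary cyclotomic cosets of the points `(x, y)` of the narrow-sense designed
set of designed distance `d`. -/
def hyperbolicZeros (Q n d : ℕ) : Set (ℕ × ℕ) :=
  ⋃ z ∈ designedSet n n 0 0 d, cyclotomicCoset₂ Q n n z

variable {Q n d m : ℕ}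

theorem mem_hyperbolicZeros {a b : ℕ} : (a, b) ∈ hyperbolicZeros Q n d ↔
    ∃ x y k, 1 ≤ x ∧ x ≤ n ∧ 1 ≤ y ∧ y ≤ n ∧ x * y < d ∧
      x * Q ^ k % n = a ∧ y * Q ^ k % n = b := by
  simp only [hyperbolicZeros, designedSet, cyclotomicCoset₂, Set.mem_iUnion, Set.mem_range,
    zero_add, exists_prop]
  constructor
  · rintro ⟨_, ⟨x, y, h1, h2, h3, h4, h5, rfl⟩, k, hk⟩
    simp only [Prod.mk.injEq, Nat.mod_mul_mod] at hk
    exact ⟨x, y, k, h1, h2, h3, h4, h5, hk.1, hk.2⟩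
  · rintro ⟨x, y, k, h1, h2, h3, h4, h5, rfl, rfl⟩
    exact ⟨_, ⟨x, y, h1, h2, h3, h4, h5, rfl⟩, k, by simp⟩

theorem lt_of_mem_hyperbolicZeros (hn : 0 < n) :
    ∀ z ∈ hyperbolicZeros Q n d, z.1 < n ∧ z.2 < n := by
  rintro ⟨a, b⟩ h
  obtain ⟨x, y, k, -, -, -, -, -, rfl, rfl⟩ := mem_hyperbolicZeros.1 h
  exact ⟨Nat.mod_lt _ hn, Nat.mod_lt _ hn⟩

theorem mul_mem_hyperbolicZeros_iff (hm : 0 < m) (hQ : Q ^ m ≡ 1 [MOD n]) (a b : ℕ) (ha : a < n)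
    (hb : b < n) :
    (a * Q % n, b * Q % n) ∈ hyperbolicZeros Q n d ↔ (a, b) ∈ hyperbolicZeros Q n d := by
  rw [mem_hyperbolicZeros, mem_hyperbolicZeros]
  constructor
  · rintro ⟨x, y, k, h1, h2, h3, h4, h5, h6, h7⟩
    have key : ∀ u c : ℕ, c < n → u * Q ^ k % n = c * Q % n → u * Q ^ (k + (m - 1)) % n = c := by
      intro u c hc h
      have h8 : u * Q ^ (k + (m - 1)) ≡ c [MOD n] := by
        calc u * Q ^ (k + (m - 1)) = u * Q ^ k * Q ^ (m - 1) := by rw [pow_add, mul_assoc]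
          _ ≡ c * Q * Q ^ (m - 1) [MOD n] := Nat.ModEq.mul_right _ h
          _ = c * Q ^ m := by rw [mul_assoc, ← pow_succ', Nat.sub_add_cancel hm]
          _ ≡ c * 1 [MOD n] := hQ.mul_left c
          _ = c := mul_one c
      exact Nat.mod_eq_of_modEq h8 hc
    exact ⟨x, y, _, h1, h2, h3, h4, h5, key x a ha h6, key y b hb h7⟩
  · rintro ⟨x, y, k, h1, h2, h3, h4, h5, rfl, rfl⟩
    exact ⟨x, y, k + 1, h1, h2, h3, h4, h5, by simp [pow_succ, mul_assoc],
      by simp [pow_succ, mul_assoc]⟩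

theorem zero_notMem_hyperbolicZeros (hQ : Nat.Coprime n Q) (hd : d ≤ n) :
    (0, 0) ∉ hyperbolicZeros Q n d := by
  rw [mem_hyperbolicZeros]
  rintro ⟨x, y, k, h1, h2, h3, h4, h5, h6, -⟩
  have : n ≤ x :=
    Nat.le_of_dvd h1 ((hQ.pow_right k).dvd_of_dvd_mul_right (Nat.dvd_of_mod_eq_zero h6))
  nlinarith

/-- The zeros of a hyperbolic code over the field with `q²` elements are disjoint from their
multiples by `-q`. -/
theorem not_dvd_of_mem_hyperbolicZeros {q : ℕ} (hq : 2 ≤ q) (hm : 0 < m)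
    (hd : d < deltaH q m) :
    ∀ z ∈ hyperbolicZeros (q ^ 2) (q ^ (2 * m) - 1) d,
      ∀ w ∈ hyperbolicZeros (q ^ 2) (q ^ (2 * m) - 1) d,
        q ^ (2 * m) - 1 ∣ w.1 + q * z.1 → ¬ q ^ (2 * m) - 1 ∣ w.2 + q * z.2 := by
  have hpos : 1 ≤ q ^ (2 * m) := Nat.one_le_pow _ _ (by omega)
  have hone : q ^ (2 * m) ≡ 1 [MOD q ^ (2 * m) - 1] := by
    simpa using (Nat.modEq_iff_dvd' hpos).2 dvd_rfl |>.symm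
  generalize hn : q ^ (2 * m) - 1 = n at *
  rintro ⟨a, b⟩ hz ⟨a', b'⟩ hw h1 h2
  obtain ⟨x, y, k, hx1, hxn, hy1, hyn, hxy, rfl, rfl⟩ := mem_hyperbolicZeros.1 hz
  obtain ⟨x', y', k', hx1', hxn', hy1', hyn', hxy', rfl, rfl⟩ := mem_hyperbolicZeros.1 hw
  -- multiplication by `q ^ (2 (m - 1) k')` undoes multiplication by `(q²) ^ k'`
  have key : ∀ u u' : ℕ, n ∣ u' * (q ^ 2) ^ k' % n + q * (u * (q ^ 2) ^ k % n) →
      n ∣ u' + q ^ (2 * ((m - 1) * k' + k) + 1) * u := by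
    intro u u' h
    have h3 : n ∣ u' * (q ^ 2) ^ k' + q * (u * (q ^ 2) ^ k) :=
      (Nat.ModEq.dvd_iff ((Nat.mod_modEq _ _).add ((Nat.mod_modEq _ _).mul_left q)) dvd_rfl).1 h
    have h4 := h3.mul_left (q ^ (2 * ((m - 1) * k')))
    have h5 : q ^ (2 * ((m - 1) * k')) * (u' * (q ^ 2) ^ k' + q * (u * (q ^ 2) ^ k)) =
        (q ^ (2 * m)) ^ k' * u' + q ^ (2 * ((m - 1) * k' + k) + 1) * u := by
      obtain ⟨r, rfl⟩ : ∃ r, m = r + 1 := ⟨m - 1, by omega⟩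
      simp only [Nat.add_sub_cancel]
      ring
    rw [h5] at h4
    refine (Nat.ModEq.dvd_iff ?_ dvd_rfl).1 h4
    simpa using ((hone.pow k').mul_right u').add_right (q ^ (2 * ((m - 1) * k' + k) + 1) * u)
  subst hn
  exact not_dvd_of_odd hq hm (odd_two_mul_add_one _) hx1 hx1' hy1 hy1' hxn hyn hxn' hyn'
    (hxy.trans hd) (hxy'.trans hd) (key x x' h1) (key y y' h2)

end HyperbolicZeros

/-! ### Quantum hyperbolic codes -/

theorem mainTheorem6 (p : ℕ) [Fact p.Prime]
    {F K : Type*} [Field F] [Fintype F] [Algebra (ZMod p) F]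
    [Field K] [Fintype K] [Algebra F K]
    (q m n d : ℕ) (hF : Fintype.card F = q) (hK : Fintype.card K = q ^ 2)
    (hm : 3 < m) (hn : n = q ^ (2 * m) - 1) (hd : d < deltaH q m) :
    ∃ C : Submodule K (Fin n × Fin n → K),
      IsPrimitiveNarrowSenseHyperbolic d C ∧
      hermitianDual F C ⊆ (C : Set (Fin n × Fin n → K)) ∧
      n ^ 2 < 2 * Module.finrank K C ∧
      ∃ Q : Submodule ℂ (QuditSpace F (Fin n × Fin n)),
        IsHermitianConstruction p C Q ∧
        Module.finrank ℂ Q = q ^ (2 * Module.finrank K C - n ^ 2) ∧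
        HasDistanceAtLeast p d Q := by
  have hq : 2 ≤ q := hF ▸ Fintype.one_lt_card
  have hdn := deltaH_add_pow_le (l := 0) hq (show 0 < m by omega)
  rw [← hn, pow_zero] at hdn
  have hn1 : n + 1 = Fintype.card K ^ m := by
    rw [hn, Nat.sub_add_cancel (Nat.one_le_pow _ _ (by omega)), hK, pow_mul]
  have hnlen : n = Fintype.card K ^ m - 1 := by omega
  have hcop : Nat.Coprime n (Fintype.card K) :=
    Nat.Coprime.coprime_dvd_right (dvd_pow_self _ (by omega : m ≠ 0))
      (hn1 ▸ (Nat.coprime_self_add_right.2 (Nat.coprime_one_right n)))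
  have hone : Fintype.card K ^ m ≡ 1 [MOD n] := by
    rw [← hn1]; simp [Nat.ModEq]
  -- `n` is invertible in `K`, since `n + 1` is a power of `|K|`
  have hnK : (n : K) = -1 := by
    have h := congrArg (Nat.cast (R := K)) hn1
    rw [Nat.cast_pow, FiniteField.cast_card_eq_zero, zero_pow (by omega : m ≠ 0)] at h
    push_cast at h
    exact eq_neg_of_add_eq_zero_left h
  have hnpos : 0 < n := by omega
  have : NeZero n := ⟨hnpos.ne'⟩
  have : NeZero (n : K) := ⟨by rw [hnK]; exact neg_ne_zero.2 one_ne_zero⟩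
  obtain ⟨α, hα⟩ := HasEnoughRootsOfUnity.prim (M := AlgebraicClosure K) (n := n)
  have hnL : (n : AlgebraicClosure K) ≠ 0 := hα.neZero'.ne
  have hZ := lt_of_mem_hyperbolicZeros (Q := Fintype.card K) (d := d) hnpos
  have hZQ := mul_mem_hyperbolicZeros_iff (d := d) (show 0 < m by omega) hone
  have h0 := zero_notMem_hyperbolicZeros hcop (show d ≤ n by omega)
  have hneg := not_dvd_of_mem_hyperbolicZeros hq (show 0 < m by omega) hd
  rw [← hK, ← hn, ← hF] at hneg
  have hdef := definingSet_zeroCode hα hcop hnL hZ hZQ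
  have hsub := hermitianDual_zeroCode_subset (F := F) hα hcop hnL hZ hZQ hneg
  have hKF : Fintype.card K = Fintype.card F ^ 2 := hK.trans (by rw [hF])
  have hdim := lt_two_mul_finrank hKF hsub (one_mem_zeroCode hα hZ h0)
    (one_notMem_hermitianDual hnpos (by rw [hdef]; exact h0))
  have hcard : Fintype.card (Fin n × Fin n) = n ^ 2 := by simp [sq]
  have hdist : ∀ c ∈ zeroCode K n α (hyperbolicZeros (Fintype.card K) n d), c ≠ 0 →
      d ≤ {i | c i ≠ 0}.ncard := by
    intro c hc hc0
    refine le_card_support_of_codePolyEval_eq_zero hα hnL hc0 fun x y hx1 hxn hy1 hyn hxy => ?_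
    have h := hc (x % n, y % n)
      (mem_hyperbolicZeros.2 ⟨x, y, 0, hx1, hxn, hy1, hyn, hxy, by simp, by simp⟩)
    rwa [hα.pow_eq_pow_of_modEq (Nat.mod_modEq x n),
      hα.pow_eq_pow_of_modEq (Nat.mod_modEq y n)] at h
  have hQ := exists_isHermitianConstruction p hKF hsub hdim.le hdist
  rw [hcard] at hdim
  rw [hcard, hF] at hQ
  exact ⟨_, ⟨⟨m, hnlen⟩, ⟨m, hnlen⟩, isBicyclic_zeroCode hα.pow_eq_one hcop _, α, α, hα, hα, hdef⟩,
    hsub, hdim, hQ⟩
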